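/- Let $f:\mathbb R^n\times\mathbb R^d\to\mathbb R$ be continuously differentiable, let $\mathcal X\subset\mathbb R^n$, $\mathcal Y\subset\mathbb R^d$ be nonempty, convex and compact, and let $L,\lambda>0$ be such that for all $x,x'\in\mathcal X$, $y,y'\in\mathcal Y$ $$\|\nabla_xf(x,y)-\nabla_xf(x',y')\|\le L(\|x-x'\|+\|y-y'\|),\qquad \|\nabla_yf(x,y)-\nabla_yf(x',y')\|\le \lambda L(\|x-x'\|+\|y-y'\|).$$ Put $F(x,y,z,v)=f(x,y)+\frac{r_1}{2}\|x-z\|^2-\frac{r_2}{2}\|y-v\|^2$. Given $x^0,z^0\in\mathbb R^n$ and $y^0,v^0\in\mathbb R^d$, DS-GDA computes for $t=0,\dots,T$ $$x^{t+1}=\mathrm{proj}_{\mathcal X}(x^t-c\nabla_xF(x^t,y^t,z^t,v^t)),\quad y^{t+1}=\mathrm{proj}_{\mathcal Y}(y^t+\alpha\nabla_yF(x^{t+1},y^t,z^t,v^t)),$$ $$z^{t+1}=z^t+\beta(x^{t+1}-z^t),\qquad v^{t+1}=v^t+\mu(y^{t+1}-v^t).$$ Assume $r_1\ge 2L$, $r_2\ge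 2\lambda L$, $0<\beta,\mu<1$ and, with $\sigma=\frac{2cr_1+1}{c(r_1-L)}$ and $L_d=\left(\frac{\lambda L}{r_1-L}+2\right)\lambda L+r_2$, $$0<c\le\min\Big\{\tfrac{4}{3(L+r_1)},\tfrac1{6\lambda L}\Big\},\qquad 0<\alpha\le\min\Big\{\tfrac{2}{3\lambda L\sigma^2},\tfrac1{6L_d},\tfrac{1}{5\lambda\sqrt{\lambda+5}\,L}\Big\},$$ $$0<\beta\le\min\Big\{\tfrac{24r_1}{360r_1+5r_1^2\lambda+(2\lambda L+5r_1)^2},\tfrac{\alpha\lambda^2L^2}{384r_1(\lambda+5)(\lambda+1)^2}\Big\},\qquad 0<\mu\le\min\Big\{\tfrac{2(\lambda+5)}{2(\lambda+5)+\lambda^2L^2},\tfrac{\alpha\lambda^2L^2}{64r_2(\lambda+5)}\Big\}.$$ Write $\mathbf 1_S$ for the indicator function of a set $S$ ($0$ on $S$, $+\infty$ elsewhere) and $\partial\mathbf 1_S$ for its subdifferential. A point $(\hat x,\hat y)\in\mathcal X\times\mathcal Y$ is an $\epsilon$-game stationary point ($\epsilon$-GS) if $\mathrm{dist}(0,\nabla_xf(\hat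 x,\hat y)+\partial\mathbf 1_{\mathcal X}(\hat x))\le\epsilon$ and $\mathrm{dist}(0,-\nabla_yf(\hat x,\hat y)+\partial\mathbf 1_{\mathcal Y}(\hat y))\le\epsilon$. A point $\hat z\in\mathbb R^n$ is an $\epsilon$-optimization stationary point ($\epsilon$-OS) if $\|x^*(\hat z)-\hat z\|\le\epsilon$, where $x^*(\hat z)=\arg\min_{x\in\mathcal X}\{\max_{y\in\mathcal Y}f(x,y)+\frac{r_1}{2}\|x-\hat z\|^2\}$. The dual function has the KŁ property with exponent $\theta\in(0,1)$ and constant $\tau>0$ if for all $x\in\mathcal X$, $y\in\mathcal Y$ $$\Big(\max_{y'\in\mathcal Y}f(x,y')-f(x,y)\Big)^\theta\le\frac1\tau\,\mathrm{dist}\big(0,-\nabla_yf(x,y)+\partial\mathbf 1_{\mathcal Y}(y)\big).$$ Below, $f,\mathcal X,\mathcal Y,L,\lambda,r_1,r_2,c,\alpha,\mu$ and the initial point (and $\theta,\tau$) are fixed, $T\ge1$ is an integer, and $\beta$ (which may depend on $T$) is subject to the bounds above. (i) Let the dual function have the KŁ property with exponent $\theta\in(\frac12,1)$. For every $\kappa_2>0$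 there is $C>0$ such that for all $T\ge1$, $\kappa_1>0$ and $\beta$ with $\kappa_1T^{-\frac{2\theta-1}{2\theta}}\le\beta\le\kappa_2T^{-\frac{2\theta-1}{2\theta}}$, some $t\in\{1,\dots,T\}$ is such that $(x^{t+1},y^{t+1})$ is an $\epsilon$-GS and $z^{t+1}$ is an $\epsilon$-OS with $\epsilon=C\kappa_1^{-1/2}\,T^{-\frac1{4\theta}}$. (ii) Let the dual function have the KŁ property with exponent $\theta\in(0,\frac12]$ and constant $\tau$, and let $\omega_0=\frac{2}{(r_1-L)\tau^{1/\theta}}\Big(\frac{r_2(1-\mu)}{\mu}+\frac{r_2^2}{r_2-\lambda L}\Big)^{1/\theta}$. There is $C>0$ such that for all $T\ge1$ and all $\beta$ with $32\,r_1\mu\,\omega_0\,(2\,\mathrm{diam}(\mathcal Y))^{\frac1\theta-2}\,\beta\le r_2$ (where $0^0=1$), some $t\in\{1,\dots,T\}$ is such that $(x^{t+1},y^{t+1})$ is an $\epsilon$-GS and $z^{t+1}$ is an $\epsilon$-OS with $\epsilon=C\beta^{-1/2}\,T^{-1/2}$. (iii) Let $f(x,\cdot)$ be concave on $\mathcal Y$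 for every $x\in\mathcal X$. For every $\kappa_2>0$ there is $C>0$ such that for all $T\ge1$, $\kappa_1>0$ and $\beta$ with $\kappa_1T^{-1/2}\le\beta\le\kappa_2T^{-1/2}$, some $t\in\{1,\dots,T\}$ is such that $(x^{t+1},y^{t+1})$ is an $\epsilon$-GS and $z^{t+1}$ is an $\epsilon$-OS with $\epsilon=C\kappa_1^{-1/2}\,T^{-1/4}$. -/

import Mathlib

open scoped Gradient InnerProductSpace

noncomputable section

namespace DSGDA

/-- Euclidean space of dimension `n`. -/
abbrev E (n : ℕ) := EuclideanSpace ℝ (Fin n)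

/-- `u` is the Euclidean projection of `p` onto `S`, that is, a nearest point of `S`
(unique when `S` is closed and convex). -/
def IsProj {n : ℕ} (S : Set (E n)) (p u : E n) : Prop :=
  u ∈ S ∧ ∀ w ∈ S, ‖u - p‖ ≤ ‖w - p‖

/-- Subdifferential at `x` of the indicator function of a convex set `S`
(equal to `0` on `S` and `+∞` off `S`): the normal cone, empty when `x ∉ S`. -/
def subdiffIndicator {n : ℕ} (S : Set (E n)) (x : E n) : Set (E n) :=
  {ξ | x ∈ S ∧ ∀ w ∈ S, ⟪ξ, w - x⟫_ℝ ≤ 0}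

/-- `dist (0, g + ∂ 1_S (x))`. -/
def statDist {n : ℕ} (S : Set (E n)) (g x : E n) : ℝ :=
  Metric.infDist (0 : E n) ((fun ξ => g + ξ) '' subdiffIndicator S x)

variable {n d : ℕ}

/-- Partial gradient in the first variable. -/
def gradX (f : E n → E d → ℝ) (x : E n) (y : E d) : E n := ∇ (fun x' => f x' y) x

/-- Partial gradient in the second variable. -/
def gradY (f : E n → E d → ℝ) (x : E n) (y : E d) : E d := ∇ (fun y' => f x y') y

/-- `f` is continuously differentiable and its partial gradients are Lipschitz on `X × Y`
with constants `Lx` and `Ly`. -/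
structure LipschitzGrad (f : E n → E d → ℝ) (X : Set (E n)) (Y : Set (E d))
    (Lx Ly : ℝ) : Prop where
  contDiff : ContDiff ℝ 1 (fun p : E n × E d => f p.1 p.2)
  lipX : ∀ x ∈ X, ∀ x' ∈ X, ∀ y ∈ Y, ∀ y' ∈ Y,
    ‖gradX f x y - gradX f x' y'‖ ≤ Lx * (‖x - x'‖ + ‖y - y'‖)
  lipY : ∀ x ∈ X, ∀ x' ∈ X, ∀ y ∈ Y, ∀ y' ∈ Y,
    ‖gradY f x y - gradY f x' y'‖ ≤ Ly * (‖x - x'‖ + ‖y - y'‖)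

/-- The doubly regularized function `F(x,y,z,v)`. -/
def regF (f : E n → E d → ℝ) (r₁ r₂ : ℝ) (z : E n) (v : E d) (x : E n) (y : E d) : ℝ :=
  f x y + r₁ / 2 * ‖x - z‖ ^ 2 - r₂ / 2 * ‖y - v‖ ^ 2

/-- `x, y, z, v` are iterates of DS-GDA, run for `t = 0, …, T`, with primal stepsize `c`, dual
stepsize `α`, extrapolation parameters `β`, `μ` and smoothing parameters `r₁`, `r₂`. -/
structure IsRun (f : E n → E d → ℝ) (X : Set (E n)) (Y : Set (E d)) (r₁ r₂ c α β μ : ℝ)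
    (T : ℕ) (x : ℕ → E n) (y : ℕ → E d) (z : ℕ → E n) (v : ℕ → E d) : Prop where
  stepX : ∀ t ≤ T, IsProj X (x t - c • gradX (regF f r₁ r₂ (z t) (v t)) (x t) (y t)) (x (t + 1))
  stepY : ∀ t ≤ T,
    IsProj Y (y t + α • gradY (regF f r₁ r₂ (z t) (v t)) (x (t + 1)) (y t)) (y (t + 1))
  stepZ : ∀ t ≤ T, z (t + 1) = z t + β • (x (t + 1) - z t)
  stepV : ∀ t ≤ T, v (t + 1) = v t + μ • (y (t + 1) - v t)

/-- `max_{y ∈ Y} f(x,y)` (attained for compact nonempty `Y` and continuous `f`). -/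
def maxY (f : E n → E d → ℝ) (Y : Set (E d)) (x : E n) : ℝ := sSup ((fun y => f x y) '' Y)

/-- `(x, y)` is an `ε`-game stationary point. -/
def IsGS (f : E n → E d → ℝ) (X : Set (E n)) (Y : Set (E d)) (ε : ℝ) (x : E n) (y : E d) :
    Prop :=
  x ∈ X ∧ y ∈ Y ∧ statDist X (gradX f x y) x ≤ ε ∧ statDist Y (-gradY f x y) y ≤ ε

/-- `w` is a proximal point of `z` for the primal function `max_{y ∈ Y} f(·,y)` on `X`, with
proximal parameter `r`: a minimizer over `X` of `max_{y ∈ Y} f(·,y) + (r / 2) ‖· - z‖ ^ 2`. -/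
def IsProx (f : E n → E d → ℝ) (X : Set (E n)) (Y : Set (E d)) (r : ℝ) (z w : E n) : Prop :=
  w ∈ X ∧ ∀ x ∈ X, maxY f Y w + r / 2 * ‖w - z‖ ^ 2 ≤ maxY f Y x + r / 2 * ‖x - z‖ ^ 2

/-- `z` is an `ε`-optimization stationary point: its proximal point is within `ε` of `z`. -/
def IsOS (f : E n → E d → ℝ) (X : Set (E n)) (Y : Set (E d)) (r ε : ℝ) (z : E n) : Prop :=
  ∃ w, IsProx f X Y r z w ∧ ‖w - z‖ ≤ ε

/-- Global KŁ property with exponent `θ` and constant `τ` of the dual function. -/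
def DualKL (f : E n → E d → ℝ) (X : Set (E n)) (Y : Set (E d)) (τ θ : ℝ) : Prop :=
  ∀ x ∈ X, ∀ y ∈ Y, (maxY f Y x - f x y) ^ θ ≤ 1 / τ * statDist Y (-gradY f x y) y

/-- Concavity of the dual function. -/
def DualConcave (f : E n → E d → ℝ) (X : Set (E n)) (Y : Set (E d)) : Prop :=
  ∀ x ∈ X, ConcaveOn ℝ Y (fun y => f x y)

/-- The constant `σ`. -/
def sigma (L r₁ c : ℝ) : ℝ := (2 * c * r₁ + 1) / (c * (r₁ - L))

/-- The constant `L_d`. -/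
def Ld (L lam r₁ r₂ : ℝ) : ℝ := (lam * L / (r₁ - L) + 2) * (lam * L) + r₂

/-- Conditions on all the parameters except `β`. -/
structure ParamBounds (L lam r₁ r₂ c α μ : ℝ) : Prop where
  r₁_ge : 2 * L ≤ r₁
  r₂_ge : 2 * lam * L ≤ r₂
  c_pos : 0 < c
  c_le : c ≤ min (4 / (3 * (L + r₁))) (1 / (6 * lam * L))
  α_pos : 0 < α
  α_le : α ≤ min (2 / (3 * lam * L * sigma L r₁ c ^ 2))
    (min (1 / (6 * Ld L lam r₁ r₂)) (1 / (5 * lam * √(lam + 5) * L)))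
  μ_pos : 0 < μ
  μ_lt_one : μ < 1
  μ_le : μ ≤ min (2 * (lam + 5) / (2 * (lam + 5) + lam ^ 2 * L ^ 2))
    (α * lam ^ 2 * L ^ 2 / (64 * r₂ * (lam + 5)))

/-- Conditions on `β`. -/
structure BetaBounds (L lam r₁ α β : ℝ) : Prop where
  β_pos : 0 < β
  β_lt_one : β < 1
  β_le : β ≤ min
    (24 * r₁ / (360 * r₁ + 5 * r₁ ^ 2 * lam + (2 * lam * L + 5 * r₁) ^ 2))
    (α * lam ^ 2 * L ^ 2 / (384 * r₁ * (lam + 5) * (lam + 1) ^ 2))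

/-- The constant `ω₀`. -/
def omega0 (L lam r₁ r₂ μ τ θ : ℝ) : ℝ :=
  2 / ((r₁ - L) * τ ^ (1 / θ)) * (r₂ * (1 - μ) / μ + r₂ ^ 2 / (r₂ - lam * L)) ^ (1 / θ)

/-- Some `t ∈ {1, …, T}` is such that `(x (t+1), y (t+1))` is an `ε`-game stationary point and
`z (t+1)` is an `ε`-optimization stationary point. -/
def FindsStationary (f : E n → E d → ℝ) (X : Set (E n)) (Y : Set (E d)) (r₁ : ℝ) (T : ℕ)
    (x : ℕ → E n) (y : ℕ → E d) (z : ℕ → E n) (ε : ℝ) : Prop :=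
  ∃ t : ℕ, 1 ≤ t ∧ t ≤ T ∧ IsGS f X Y ε (x (t + 1)) (y (t + 1)) ∧ IsOS f X Y r₁ ε (z (t + 1))

end DSGDA

end

namespace DSGDA

section Analysis

variable {V : Type*} [NormedAddCommGroup V] [InnerProductSpace ℝ V] [CompleteSpace V]

/-- One-sided quadratic bound for a function whose gradient is Lipschitz on a convex set. -/
lemma le_quadratic_of_lipschitz_gradient {g : V → ℝ} {g' : V → V} {S : Set V} {K : ℝ}
    (hg : ∀ x, HasGradientAt g (g' x) x) (hS : Convex ℝ S)
    (hK : ∀ x ∈ S, ∀ x' ∈ S, ‖g' x - g' x'‖ ≤ K * ‖x - x'‖) {x x' : V} (hx : x ∈ S)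
    (hx' : x' ∈ S) : g x' ≤ g x + ⟪g' x, x' - x⟫_ℝ + K / 2 * ‖x' - x‖ ^ 2 := by
  set h := x' - x with hh
  have hder : ∀ s : ℝ, HasDerivAt
      (fun s : ℝ => g (x + s • h) - s * ⟪g' x, h⟫_ℝ - K / 2 * s ^ 2 * ‖h‖ ^ 2)
      (⟪g' (x + s • h), h⟫_ℝ - ⟪g' x, h⟫_ℝ - K * s * ‖h‖ ^ 2) s := by
    intro s
    have h1 : HasDerivAt (fun s : ℝ => x + s • h) h s := by
      simpa using ((hasDerivAt_id s).smul_const h).const_add x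
    have h2 := (hg (x + s • h)).hasFDerivAt.comp_hasDerivAt s h1
    have h3 : HasDerivAt (fun s : ℝ => s * ⟪g' x, h⟫_ℝ) (⟪g' x, h⟫_ℝ) s := by
      simpa using (hasDerivAt_id s).mul_const (⟪g' x, h⟫_ℝ)
    have h4 : HasDerivAt (fun s : ℝ => K / 2 * s ^ 2 * ‖h‖ ^ 2) (K * s * ‖h‖ ^ 2) s := by
      have := (((hasDerivAt_id s).pow 2).const_mul (K / 2)).mul_const (‖h‖ ^ 2)
      refine this.congr_deriv ?_
      simp only [id, Nat.cast_ofNat]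
      ring
    exact ((h2.sub h3).sub h4).congr_deriv (by simp)
  have hanti : AntitoneOn
      (fun s : ℝ => g (x + s • h) - s * ⟪g' x, h⟫_ℝ - K / 2 * s ^ 2 * ‖h‖ ^ 2)
      (Set.Icc 0 1) := by
    refine antitoneOn_of_deriv_nonpos (convex_Icc 0 1)
      (fun s _ => (hder s).continuousAt.continuousWithinAt)
      (fun s _ => (hder s).differentiableAt.differentiableWithinAt) ?_
    intro s hs
    rw [interior_Icc] at hs
    rw [(hder s).deriv]
    have hmem : x + s • h ∈ S := hS.add_smul_sub_mem hx hx' ⟨hs.1.le, hs.2.le⟩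
    have h1 := hK _ hmem _ hx
    have h2 : ⟪g' (x + s • h) - g' x, h⟫_ℝ ≤ ‖g' (x + s • h) - g' x‖ * ‖h‖ :=
      real_inner_le_norm _ _
    rw [inner_sub_left] at h2
    have h3 : ‖x + s • h - x‖ = s * ‖h‖ := by
      rw [add_sub_cancel_left, norm_smul, Real.norm_of_nonneg hs.1.le]
    rw [h3] at h1
    nlinarith [mul_le_mul_of_nonneg_right h1 (norm_nonneg h)]
  have := hanti (Set.left_mem_Icc.2 zero_le_one) (Set.right_mem_Icc.2 zero_le_one) zero_le_one
  simp only [one_smul, zero_smul, add_zero] at this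
  have e : x + h = x' := by rw [hh]; abel
  rw [e] at this
  linarith

lemma quadratic_le_of_lipschitz_gradient {g : V → ℝ} {g' : V → V} {S : Set V} {K : ℝ}
    (hg : ∀ x, HasGradientAt g (g' x) x) (hS : Convex ℝ S)
    (hK : ∀ x ∈ S, ∀ x' ∈ S, ‖g' x - g' x'‖ ≤ K * ‖x - x'‖) {x x' : V} (hx : x ∈ S)
    (hx' : x' ∈ S) : g x + ⟪g' x, x' - x⟫_ℝ - K / 2 * ‖x' - x‖ ^ 2 ≤ g x' := by
  have := le_quadratic_of_lipschitz_gradient (g := fun x => - g x) (g' := fun x => - g' x)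
    (S := S) (K := K)
    (fun x => by
      have := (hg x).hasFDerivAt.neg
      rw [hasGradientAt_iff_hasFDerivAt, map_neg]
      exact this) hS
    (fun x hx x' hx' => by
      have := hK x hx x' hx'
      rwa [← norm_neg, neg_sub, ← neg_sub_neg] at this) hx hx'
  simp only [inner_neg_left] at this
  linarith

/-- If `s ↦ s a + s² b` is nonnegative on `(0, 1]`, then its slope `a` at `0` is nonnegative. -/
lemma nonneg_of_forall_quadratic_nonneg {a b : ℝ}
    (h : ∀ s : ℝ, 0 < s → s ≤ 1 → 0 ≤ s * a + s ^ 2 * b) : 0 ≤ a := by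
  by_contra hneg
  push Not at hneg
  have hb : 0 < |b| + 1 := by positivity
  set s := min 1 (-a / (2 * (|b| + 1))) with hs
  have hs0 : 0 < s := lt_min one_pos (div_pos (by linarith) (by positivity))
  have h1 := h s hs0 (min_le_left _ _)
  have h2 : s * (|b| + 1) ≤ -a / 2 := by
    calc s * (|b| + 1) ≤ -a / (2 * (|b| + 1)) * (|b| + 1) :=
          mul_le_mul_of_nonneg_right (min_le_right _ _) hb.le
      _ = -a / 2 := by field_simp
  have h3 : 0 ≤ a + s * b := by
    have : 0 ≤ s * (a + s * b) := by linarith [h1, mul_add s a (s * b)]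
    exact nonneg_of_mul_nonneg_right this hs0
  have h4 : s * b ≤ s * (|b| + 1) :=
    mul_le_mul_of_nonneg_left (by linarith [le_abs_self b]) hs0.le
  linarith

end Analysis

variable {n d : ℕ}

lemma IsProj.inner_le_zero {S : Set (E n)} (hS : Convex ℝ S) {p u : E n} (h : IsProj S p u)
    {w : E n} (hw : w ∈ S) : ⟪p - u, w - u⟫_ℝ ≤ 0 := by
  have key : 0 ≤ -2 * ⟪p - u, w - u⟫_ℝ := by
    refine nonneg_of_forall_quadratic_nonneg (b := ‖w - u‖ ^ 2) fun s hs hs1 => ?_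
    have hm : u + s • (w - u) ∈ S := hS.add_smul_sub_mem h.1 hw ⟨hs.le, hs1⟩
    have h1 := h.2 _ hm
    have h2 : ‖u + s • (w - u) - p‖ ^ 2
        = ‖u - p‖ ^ 2 - 2 * (s * ⟪p - u, w - u⟫_ℝ) + s ^ 2 * ‖w - u‖ ^ 2 := by
      have : u + s • (w - u) - p = s • (w - u) - (p - u) := by abel
      rw [this, @norm_sub_sq_real, norm_smul, mul_pow, real_inner_smul_left,
        norm_sub_rev u p, real_inner_comm, Real.norm_eq_abs, sq_abs]
      ring
    have h3 : ‖u - p‖ ^ 2 ≤ ‖u + s • (w - u) - p‖ ^ 2 :=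
      pow_le_pow_left₀ (norm_nonneg _) h1 2
    linarith
  linarith

lemma statDist_le {S : Set (E n)} {g x ξ : E n} (hx : x ∈ S)
    (hξ : ∀ w ∈ S, ⟪ξ, w - x⟫_ℝ ≤ 0) : statDist S g x ≤ ‖g + ξ‖ := by
  have : g + ξ ∈ (fun ξ => g + ξ) '' subdiffIndicator S x := ⟨ξ, ⟨hx, hξ⟩, rfl⟩
  have h := Metric.infDist_le_dist_of_mem (x := (0 : E n)) this
  rwa [dist_zero_left] at h

section Grad

variable {f : E n → E d → ℝ} {X : Set (E n)} {Y : Set (E d)} {Lx Ly r₁ r₂ : ℝ}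

lemma LipschitzGrad.hasGradientAt_x (hf : LipschitzGrad f X Y Lx Ly) (x : E n) (y : E d) :
    HasGradientAt (fun x' => f x' y) (gradX f x y) x := by
  refine DifferentiableAt.hasGradientAt ?_
  have h := hf.contDiff.differentiable one_ne_zero
  exact (h.comp (differentiable_id.prodMk (differentiable_const y))) x

lemma LipschitzGrad.hasGradientAt_y (hf : LipschitzGrad f X Y Lx Ly) (x : E n) (y : E d) :
    HasGradientAt (fun y' => f x y') (gradY f x y) y := by
  refine DifferentiableAt.hasGradientAt ?_
  have h := hf.contDiff.differentiable one_ne_zero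
  exact (h.comp ((differentiable_const x).prodMk differentiable_id)) y

lemma hasGradientAt_half_norm_sq (r : ℝ) (z x : E n) :
    HasGradientAt (fun x' => r / 2 * ‖x' - z‖ ^ 2) (r • (x - z)) x := by
  rw [hasGradientAt_iff_hasFDerivAt]
  have h := (((hasFDerivAt_id x).sub_const z).norm_sq).const_mul (r / 2)
  refine h.congr_fderiv ?_
  ext w
  simp
  ring

lemma hasGradientAt_add {g h : E n → ℝ} {a b x : E n} (hg : HasGradientAt g a x)
    (hh : HasGradientAt h b x) : HasGradientAt (fun x => g x + h x) (a + b) x := by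
  rw [hasGradientAt_iff_hasFDerivAt] at *
  rw [map_add]
  exact hg.add hh

lemma hasGradientAt_sub_const {g : E n → ℝ} {a x : E n} (hg : HasGradientAt g a x) (k : ℝ) :
    HasGradientAt (fun x => g x - k) a x := by
  rw [hasGradientAt_iff_hasFDerivAt] at *
  exact HasFDerivAt.sub_const k hg

lemma LipschitzGrad.gradX_regF (hf : LipschitzGrad f X Y Lx Ly) (z : E n) (v : E d) (x : E n)
    (y : E d) : gradX (regF f r₁ r₂ z v) x y = gradX f x y + r₁ • (x - z) :=
  HasGradientAt.gradient (hasGradientAt_sub_const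
    (hasGradientAt_add (hf.hasGradientAt_x x y) (hasGradientAt_half_norm_sq r₁ z x)) _)

lemma LipschitzGrad.gradY_regF (hf : LipschitzGrad f X Y Lx Ly) (z : E n) (v : E d) (x : E n)
    (y : E d) : gradY (regF f r₁ r₂ z v) x y = gradY f x y - r₂ • (y - v) := by
  have h := hasGradientAt_sub_const (hasGradientAt_add (hf.hasGradientAt_y x y)
    (hasGradientAt_half_norm_sq (-r₂) v y)) (-(r₁ / 2 * ‖x - z‖ ^ 2))
  rw [sub_eq_add_neg, ← neg_smul]
  refine HasGradientAt.gradient (h.congr_of_eventuallyEq (Filter.Eventually.of_forall fun y' => ?_))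
  simp only [regF]
  ring

lemma LipschitzGrad.continuous (hf : LipschitzGrad f X Y Lx Ly) :
    Continuous (fun p : E n × E d => f p.1 p.2) := hf.contDiff.continuous

lemma LipschitzGrad.le_quadratic_x (hf : LipschitzGrad f X Y Lx Ly) (hX : Convex ℝ X)
    {x x' : E n} (hx : x ∈ X) (hx' : x' ∈ X) {y : E d} (hy : y ∈ Y) :
    f x' y ≤ f x y + ⟪gradX f x y, x' - x⟫_ℝ + Lx / 2 * ‖x' - x‖ ^ 2 :=
  le_quadratic_of_lipschitz_gradient (fun x => hf.hasGradientAt_x x y) hX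
    (fun a ha b hb => by simpa using hf.lipX a ha b hb y hy y hy) hx hx'

lemma LipschitzGrad.quadratic_le_x (hf : LipschitzGrad f X Y Lx Ly) (hX : Convex ℝ X)
    {x x' : E n} (hx : x ∈ X) (hx' : x' ∈ X) {y : E d} (hy : y ∈ Y) :
    f x y + ⟪gradX f x y, x' - x⟫_ℝ - Lx / 2 * ‖x' - x‖ ^ 2 ≤ f x' y :=
  quadratic_le_of_lipschitz_gradient (fun x => hf.hasGradientAt_x x y) hX
    (fun a ha b hb => by simpa using hf.lipX a ha b hb y hy y hy) hx hx'

lemma LipschitzGrad.le_quadratic_y (hf : LipschitzGrad f X Y Lx Ly) (hY : Convex ℝ Y)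
    {x : E n} (hx : x ∈ X) {y y' : E d} (hy : y ∈ Y) (hy' : y' ∈ Y) :
    f x y' ≤ f x y + ⟪gradY f x y, y' - y⟫_ℝ + Ly / 2 * ‖y' - y‖ ^ 2 :=
  le_quadratic_of_lipschitz_gradient (fun y => hf.hasGradientAt_y x y) hY
    (fun a ha b hb => by simpa using hf.lipY x hx x hx a ha b hb) hy hy'

lemma LipschitzGrad.quadratic_le_y (hf : LipschitzGrad f X Y Lx Ly) (hY : Convex ℝ Y)
    {x : E n} (hx : x ∈ X) {y y' : E d} (hy : y ∈ Y) (hy' : y' ∈ Y) :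
    f x y + ⟪gradY f x y, y' - y⟫_ℝ - Ly / 2 * ‖y' - y‖ ^ 2 ≤ f x y' :=
  quadratic_le_of_lipschitz_gradient (fun y => hf.hasGradientAt_y x y) hY
    (fun a ha b hb => by simpa using hf.lipY x hx x hx a ha b hb) hy hy'

end Grad

end DSGDA

namespace DSGDA

lemma norm_sub_sq_expand {n : ℕ} (x u z : E n) :
    ‖x - z‖ ^ 2 = ‖u - z‖ ^ 2 + 2 * ⟪u - z, x - u⟫_ℝ + ‖x - u‖ ^ 2 := by
  have : x - z = (u - z) + (x - u) := by abel
  rw [this, norm_add_sq_real]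

lemma norm_sub_sq_diff {n : ℕ} (u z z' : E n) :
    ‖u - z'‖ ^ 2 - ‖u - z‖ ^ 2 = ⟪z' - z, z' + z - (2 : ℝ) • u⟫_ℝ := by
  simp only [@norm_sub_sq_real, inner_sub_left, inner_sub_right, inner_add_right,
    inner_smul_right, real_inner_self_eq_norm_sq, real_inner_comm z' z, real_inner_comm z' u,
    real_inner_comm z u]
  ring

lemma le_of_mul_sq_le {a b t : ℝ} (ht : 0 ≤ t) (hb : 0 ≤ b) (h : a * t ^ 2 ≤ b * t) :
    a * t ≤ b := by
  rcases ht.eq_or_lt with rfl | ht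
  · simpa using hb
  · exact le_of_mul_le_mul_right (by nlinarith) ht

variable {n d : ℕ}

/-- `u` minimizes `f(·,y) + (r / 2) ‖· - z‖ ^ 2` over `X`. -/
def IsInner (f : E n → E d → ℝ) (X : Set (E n)) (r : ℝ) (y : E d) (z u : E n) : Prop :=
  u ∈ X ∧ ∀ x ∈ X, f u y + r / 2 * ‖u - z‖ ^ 2 ≤ f x y + r / 2 * ‖x - z‖ ^ 2

/-- `(x̄, ȳ)` is a saddle point of `F(·,·,z,v)`; optimality in the second variable is stated as a
variational inequality. -/
structure IsSaddle (f : E n → E d → ℝ) (X : Set (E n)) (Y : Set (E d)) (r₁ r₂ : ℝ) (z : E n)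
    (v : E d) (x : E n) (y : E d) : Prop where
  inner : IsInner f X r₁ y z x
  mem : y ∈ Y
  vi : ∀ y' ∈ Y, ⟪gradY f x y - r₂ • (y - v), y' - y⟫_ℝ ≤ 0

section Inner

variable {f : E n → E d → ℝ} {X : Set (E n)} {Y : Set (E d)} {L K r : ℝ}

lemma IsInner.vi (hf : LipschitzGrad f X Y L K) (hX : Convex ℝ X) {y : E d} (hy : y ∈ Y)
    {z u : E n} (h : IsInner f X r y z u) {x : E n} (hx : x ∈ X) :
    0 ≤ ⟪gradX f u y + r • (u - z), x - u⟫_ℝ := by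
  refine nonneg_of_forall_quadratic_nonneg (b := (L + r) / 2 * ‖x - u‖ ^ 2) fun s hs hs1 => ?_
  have hm : u + s • (x - u) ∈ X := hX.add_smul_sub_mem h.1 hx ⟨hs.le, hs1⟩
  have h1 := h.2 _ hm
  have h2 := hf.le_quadratic_x hX h.1 hm hy
  have h3 := norm_sub_sq_expand (u + s • (x - u)) u z
  rw [add_sub_cancel_left, norm_smul, mul_pow, Real.norm_eq_abs, sq_abs,
    real_inner_smul_right] at h2 h3
  rw [inner_add_left, real_inner_smul_left]
  rw [h3] at h1
  linarith

lemma IsInner.growth (hf : LipschitzGrad f X Y L K) (hX : Convex ℝ X) {y : E d} (hy : y ∈ Y)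
    {z u : E n} (h : IsInner f X r y z u) {x : E n} (hx : x ∈ X) :
    f u y + r / 2 * ‖u - z‖ ^ 2 + (r - L) / 2 * ‖x - u‖ ^ 2 ≤ f x y + r / 2 * ‖x - z‖ ^ 2 := by
  have h1 := h.vi hf hX hy hx
  have h2 := hf.quadratic_le_x hX h.1 hx hy
  rw [norm_sub_sq_expand x u z]
  rw [inner_add_left, real_inner_smul_left] at h1
  linarith

/-- The regularized partial gradient in `x` is strongly monotone. -/
lemma LipschitzGrad.strongly_monotone (hf : LipschitzGrad f X Y L K) {y : E d} (hy : y ∈ Y)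
    {x x' : E n} (hx : x ∈ X) (hx' : x' ∈ X) :
    -L * ‖x - x'‖ ^ 2 ≤ ⟪gradX f x y - gradX f x' y, x - x'⟫_ℝ := by
  have h1 := hf.lipX x hx x' hx' y hy y hy
  rw [sub_self, norm_zero, add_zero] at h1
  have h2 := abs_le.1 (abs_real_inner_le_norm (gradX f x y - gradX f x' y) (x - x'))
  nlinarith [norm_nonneg (x - x')]

lemma IsInner.dist_le (hf : LipschitzGrad f X Y L K) (hX : Convex ℝ X) (hL : 0 ≤ L) (hr : 0 ≤ r)
    {y y' : E d} (hy : y ∈ Y) (hy' : y' ∈ Y) {z z' u u' : E n} (h : IsInner f X r y z u)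
    (h' : IsInner f X r y' z' u') :
    (r - L) * ‖u - u'‖ ≤ L * ‖y - y'‖ + r * ‖z - z'‖ := by
  have h1 := h.vi hf hX hy h'.1
  have h2 := h'.vi hf hX hy' h.1
  have h3 := hf.strongly_monotone hy h.1 h'.1
  have h4 := hf.lipX u' h'.1 u' h'.1 y' hy' y hy
  rw [sub_self, norm_zero, zero_add, norm_sub_rev y' y] at h4
  have h5 := real_inner_le_norm (gradX f u' y' - gradX f u' y) (u - u')
  have h6 := real_inner_le_norm (z - z') (u - u')
  refine le_of_mul_sq_le (norm_nonneg _) (by positivity) ?_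
  have h7 : ⟪gradX f u y + r • (u - z), u' - u⟫_ℝ + ⟪gradX f u' y' + r • (u' - z'), u - u'⟫_ℝ
      = -⟪gradX f u y - gradX f u' y, u - u'⟫_ℝ + ⟪gradX f u' y' - gradX f u' y, u - u'⟫_ℝ
        + r * ⟪z - z', u - u'⟫_ℝ - r * ‖u - u'‖ ^ 2 := by
    rw [← real_inner_self_eq_norm_sq, ← neg_sub u u', inner_neg_right]
    simp only [inner_sub_left, inner_add_left, real_inner_smul_left]
    ring
  have h8 := mul_le_mul_of_nonneg_right h4 (norm_nonneg (u - u'))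
  have h9 := mul_le_mul_of_nonneg_left h6 hr
  nlinarith

/-- Error bound for one projected gradient step in `x`. -/
lemma IsInner.dist_le_of_isProj (hf : LipschitzGrad f X Y L K) (hX : Convex ℝ X) (hL : 0 ≤ L)
    (hr : 0 ≤ r) {c : ℝ} (hc : 0 ≤ c) {y : E d} (hy : y ∈ Y) {z u x x' : E n}
    (h : IsInner f X r y z u) (hx : x ∈ X)
    (hx' : IsProj X (x - c • (gradX f x y + r • (x - z))) x') :
    c * (r - L) * ‖x' - u‖ ≤ (1 + c * (L + r)) * ‖x' - x‖ := by
  have h1 := h.vi hf hX hy hx'.1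
  have h2 := hx'.inner_le_zero hX h.1
  have h3 := hf.strongly_monotone hy hx'.1 h.1
  have h4 := hf.lipX x' hx'.1 x hx y hy y hy
  rw [sub_self, norm_zero, add_zero] at h4
  have h5 := real_inner_le_norm (gradX f x' y - gradX f x y) (x' - u)
  have h6 := real_inner_le_norm (x' - x) (x' - u)
  have h6' := abs_le.1 (abs_real_inner_le_norm (x' - x) (x' - u))
  refine le_of_mul_sq_le (norm_nonneg _) (by positivity) ?_
  have h7 : ⟪x - c • (gradX f x y + r • (x - z)) - x', u - x'⟫_ℝ
      = ⟪x' - x, x' - u⟫_ℝ + c * ⟪gradX f x y + r • (x - z), x' - u⟫_ℝ := by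
    rw [← neg_sub x' u, inner_neg_right]
    simp only [inner_sub_left, inner_add_left, real_inner_smul_left]
    ring
  have h8 : ⟪gradX f x y + r • (x - z), x' - u⟫_ℝ - ⟪gradX f u y + r • (u - z), x' - u⟫_ℝ
      = ⟪gradX f x' y - gradX f u y, x' - u⟫_ℝ - ⟪gradX f x' y - gradX f x y, x' - u⟫_ℝ
        + r * ‖x' - u‖ ^ 2 - r * ⟪x' - x, x' - u⟫_ℝ := by
    rw [← real_inner_self_eq_norm_sq]
    simp only [inner_sub_left, inner_add_left, real_inner_smul_left]
    ring
  have h9 := mul_le_mul_of_nonneg_right h4 (norm_nonneg (x' - u))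
  have h10 := mul_le_mul_of_nonneg_left h6 hr
  have h11 : (r - L) * ‖x' - u‖ ^ 2 - (L + r) * (‖x' - x‖ * ‖x' - u‖)
      ≤ ⟪gradX f x y + r • (x - z), x' - u⟫_ℝ := by linarith
  have h12 := mul_le_mul_of_nonneg_left h11 hc
  nlinarith

lemma exists_isInner (hf : LipschitzGrad f X Y L K) (hXne : X.Nonempty) (hXc : IsCompact X)
    (r : ℝ) (y : E d) (z : E n) : ∃ u, IsInner f X r y z u := by
  have hc : Continuous fun x => f x y := hf.continuous.comp (by fun_prop : Continuous fun x => (x, y))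
  obtain ⟨u, hu, h⟩ := hXc.exists_isMinOn hXne
    (f := fun x => f x y + r / 2 * ‖x - z‖ ^ 2) (by fun_prop)
  exact ⟨u, hu, fun x hx => h hx⟩

lemma LipschitzGrad.bddAbove (hf : LipschitzGrad f X Y L K) (hYc : IsCompact Y) (x : E n) :
    BddAbove ((fun y => f x y) '' Y) :=
  (hYc.image (hf.continuous.comp (by fun_prop : Continuous fun y => (x, y)))).bddAbove

lemma LipschitzGrad.le_maxY (hf : LipschitzGrad f X Y L K) (hYc : IsCompact Y) (x : E n) {y : E d}
    (hy : y ∈ Y) : f x y ≤ maxY f Y x :=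
  le_csSup (hf.bddAbove hYc x) ⟨y, hy, rfl⟩

lemma exists_isProx (hf : LipschitzGrad f X Y L K) (hXne : X.Nonempty) (hXc : IsCompact X)
    (hYc : IsCompact Y) (r : ℝ) (z : E n) : ∃ w, IsProx f X Y r z w := by
  have hc : Continuous (maxY f Y) := hYc.continuous_sSup (f := f) hf.continuous
  obtain ⟨u, hu, h⟩ := hXc.exists_isMinOn hXne
    (f := fun x => maxY f Y x + r / 2 * ‖x - z‖ ^ 2) (by fun_prop)
  exact ⟨u, hu, fun x hx => h hx⟩

/-- Ascent of the dual function `min_{x ∈ X} F(x, ·, z, v)` (up to the regularization in `y`). -/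
lemma IsInner.ascent (hf : LipschitzGrad f X Y L K) (hX : Convex ℝ X) (hY : Convex ℝ Y)
    (hr : L < r) {y y' : E d} (hy : y ∈ Y) (hy' : y' ∈ Y) {z u u' : E n}
    (h : IsInner f X r y z u) (h' : IsInner f X r y' z u') :
    f u y + r / 2 * ‖u - z‖ ^ 2 + ⟪gradY f u y, y' - y⟫_ℝ
      - (K ^ 2 / (r - L) + K) / 2 * ‖y' - y‖ ^ 2 ≤ f u' y' + r / 2 * ‖u' - z‖ ^ 2 := by
  have hm : 0 < r - L := sub_pos.2 hr
  have h1 := h.growth hf hX hy h'.1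
  have h2 := hf.quadratic_le_y hY h'.1 hy hy'
  have h3 := hf.lipY u' h'.1 u h.1 y hy y hy
  rw [sub_self, norm_zero, add_zero] at h3
  have h4 := abs_le.1 (abs_real_inner_le_norm (gradY f u' y - gradY f u y) (y' - y))
  rw [inner_sub_left] at h4
  have h5 := mul_le_mul_of_nonneg_right h3 (norm_nonneg (y' - y))
  have h6 : K * ‖u' - u‖ * ‖y' - y‖
      ≤ (r - L) / 2 * ‖u' - u‖ ^ 2 + K ^ 2 / (r - L) / 2 * ‖y' - y‖ ^ 2 := by
    have : 0 ≤ ((r - L) * ‖u' - u‖ - K * ‖y' - y‖) ^ 2 / (2 * (r - L)) := by positivity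
    have e : ((r - L) * ‖u' - u‖ - K * ‖y' - y‖) ^ 2 / (2 * (r - L))
      = (r - L) / 2 * ‖u' - u‖ ^ 2 + K ^ 2 / (r - L) / 2 * ‖y' - y‖ ^ 2
        - K * ‖u' - u‖ * ‖y' - y‖ := by
      field_simp
      ring
    linarith
  linarith

lemma exists_isSaddle (hf : LipschitzGrad f X Y L K) (hXne : X.Nonempty) (hXc : IsCompact X)
    (hX : Convex ℝ X) (hYne : Y.Nonempty) (hYc : IsCompact Y) (hY : Convex ℝ Y) (hr : L < r)
    (r₂ : ℝ) (z : E n) (v : E d) : ∃ x y, IsSaddle f X Y r r₂ z v x y := by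
  choose u hu using fun y => exists_isInner hf hXne hXc r y z
  have hc : Continuous fun y => sInf ((fun x => f x y + r / 2 * ‖x - z‖ ^ 2) '' X) := by
    refine hXc.continuous_sInf (f := fun y x => f x y + r / 2 * ‖x - z‖ ^ 2) ?_
    have h0 : Continuous fun p : E d × E n => f p.2 p.1 :=
      hf.continuous.comp (by fun_prop : Continuous fun p : E d × E n => (p.2, p.1))
    exact h0.add (by fun_prop)
  have he : ∀ y, sInf ((fun x => f x y + r / 2 * ‖x - z‖ ^ 2) '' X)
      = f (u y) y + r / 2 * ‖u y - z‖ ^ 2 := fun y => by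
    refine IsLeast.csInf_eq ⟨⟨u y, (hu y).1, rfl⟩, ?_⟩
    rintro _ ⟨x, hx, rfl⟩
    exact (hu y).2 x hx
  simp only [he] at hc
  obtain ⟨y, hy, hmax⟩ := hYc.exists_isMaxOn hYne
    (f := fun y => f (u y) y + r / 2 * ‖u y - z‖ ^ 2 - r₂ / 2 * ‖y - v‖ ^ 2)
    (hc.sub (by fun_prop)).continuousOn
  refine ⟨u y, y, hu y, hy, fun y' hy' => ?_⟩
  have key : 0 ≤ -⟪gradY f (u y) y - r₂ • (y - v), y' - y⟫_ℝ := by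
    refine nonneg_of_forall_quadratic_nonneg
      (b := (K ^ 2 / (r - L) + K + r₂) / 2 * ‖y' - y‖ ^ 2) fun s hs hs1 => ?_
    have hm : y + s • (y' - y) ∈ Y := hY.add_smul_sub_mem hy hy' ⟨hs.le, hs1⟩
    have h1 := hmax hm
    simp only [Set.mem_ofPred_eq] at h1
    have h2 := (hu y).ascent hf hX hY hr hy hm (hu (y + s • (y' - y)))
    have h3 := norm_sub_sq_expand (y + s • (y' - y)) y v
    rw [add_sub_cancel_left, norm_smul, mul_pow, Real.norm_eq_abs, sq_abs,
      real_inner_smul_right] at h2 h3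
    rw [inner_sub_left, real_inner_smul_left]
    rw [h3] at h1
    linarith
  linarith

/-- The proximal point at `z'` is close to the `x`-component of a saddle point at `(z, v)`, up to
the duality gap. -/
lemma IsSaddle.dist_isProx_le (hf : LipschitzGrad f X Y L K) (hX : Convex ℝ X)
    (hYc : IsCompact Y) (hr0 : 0 ≤ r) {r₂ : ℝ} {z z' : E n} {v : E d} {x : E n}
    {y : E d} (h : IsSaddle f X Y r r₂ z v x y) {p : E n} (hp : IsProx f X Y r z' p) :
    (r - L) / 2 * ‖p - x‖ ^ 2 ≤ maxY f Y x - f x y + r * ‖z' - z‖ * ‖p - x‖ := by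
  have h1 := hp.2 x h.inner.1
  have h2 := hf.le_maxY hYc p h.mem
  have h3 := h.inner.growth hf hX h.mem hp.1
  have h4 := norm_sub_sq_diff p z z'
  have h5 := norm_sub_sq_diff x z z'
  have h6 := real_inner_le_norm (z' - z) (p - x)
  have h7 : ⟪z' - z, z' + z - (2 : ℝ) • x⟫_ℝ - ⟪z' - z, z' + z - (2 : ℝ) • p⟫_ℝ
      = 2 * ⟪z' - z, p - x⟫_ℝ := by
    simp only [inner_sub_right, inner_smul_right]
    ring
  have h8 := mul_le_mul_of_nonneg_left h6 hr0
  have h9 : r / 2 * ‖p - z‖ ^ 2 - r / 2 * ‖x - z‖ ^ 2 - r / 2 * ‖p - z'‖ ^ 2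
      + r / 2 * ‖x - z'‖ ^ 2 = r * ⟪z' - z, p - x⟫_ℝ := by
    linear_combination r / 2 * h5 - r / 2 * h4 + r / 2 * h7
  linarith

/-- Error bound for one projected gradient step in `y`. -/
lemma IsSaddle.dist_le_of_isProj (hf : LipschitzGrad f X Y L K)
    (hY : Convex ℝ Y) {α r₂ : ℝ} (hα : 0 ≤ α) (hK : 0 ≤ K) (hr₂ : 0 ≤ r₂)
    {z : E n} {v : E d} {xb : E n} {yb : E d} (h : IsSaddle f X Y r r₂ z v xb yb)
    {x : E n} {y y' : E d} (hx : x ∈ X) (hy : y ∈ Y) {u : E n}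
    (hu : IsInner f X r y' z u)
    (hy' : IsProj Y (y + α • (gradY f x y - r₂ • (y - v))) y') :
    α * (r₂ - K) * ‖y' - yb‖
      ≤ (1 + α * (K + r₂)) * ‖y' - y‖ + α * K * ‖x - u‖ := by
  have h1 := h.vi y' hy'.1
  have h2 := hy'.inner_le_zero hY h.mem
  have h3 := hf.le_quadratic_y hY hu.1 hy'.1 h.mem
  have h4 := hf.le_quadratic_y hY h.inner.1 h.mem hy'.1
  have h5 := h.inner.2 u hu.1
  have h6 := hu.2 xb h.inner.1
  have h7 := hf.lipY u hu.1 x hx y' hy'.1 y hy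
  have h8 := abs_le.1 (abs_real_inner_le_norm (gradY f u y' - gradY f x y) (y' - yb))
  have h9 := abs_le.1 (abs_real_inner_le_norm (y' - y) (y' - yb))
  have h10 := mul_le_mul_of_nonneg_right h7 (norm_nonneg (y' - yb))
  refine le_of_mul_sq_le (norm_nonneg _) (by positivity) ?_
  rw [norm_sub_rev yb y'] at h3
  have e1 : ⟪gradY f xb yb - r₂ • (yb - v), y' - yb⟫_ℝ
      = ⟪gradY f xb yb, y' - yb⟫_ℝ - r₂ * ⟪yb - v, y' - yb⟫_ℝ := by
    rw [inner_sub_left, real_inner_smul_left]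
  have e2 : ⟪gradY f u y', yb - y'⟫_ℝ = -⟪gradY f u y' - gradY f x y, y' - yb⟫_ℝ
      - ⟪gradY f x y, y' - yb⟫_ℝ := by
    rw [← neg_sub y' yb, inner_neg_right, inner_sub_left]; ring
  have e3 : ⟪y + α • (gradY f x y - r₂ • (y - v)) - y', yb - y'⟫_ℝ
      = ⟪y' - y, y' - yb⟫_ℝ - α * (⟪gradY f x y, y' - yb⟫_ℝ - r₂ * ⟪y - v, y' - yb⟫_ℝ) := by
    rw [← neg_sub y' yb, inner_neg_right]
    simp only [inner_sub_left, inner_add_left, real_inner_smul_left]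
    ring
  have e4 : ⟪yb - v, y' - yb⟫_ℝ = ⟪y - v, y' - yb⟫_ℝ + ⟪y' - y, y' - yb⟫_ℝ - ‖y' - yb‖ ^ 2 := by
    rw [← real_inner_self_eq_norm_sq]
    simp only [inner_sub_left]
    ring
  rw [norm_sub_rev u x] at h10
  have h11 : (r₂ - K) * ‖y' - yb‖ ^ 2 ≤ -⟪gradY f x y, y' - yb⟫_ℝ + r₂ * ⟪y - v, y' - yb⟫_ℝ
      + r₂ * ⟪y' - y, y' - yb⟫_ℝ + K * (‖x - u‖ + ‖y' - y‖) * ‖y' - yb‖ := by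
    rw [e1, e4] at h1
    rw [e2] at h3
    linarith
  have h12 := mul_le_mul_of_nonneg_left h11 hα
  have h13 := mul_le_mul_of_nonneg_left h9.2 (mul_nonneg hα hr₂)
  rw [e3] at h2
  linarith

end Inner

end DSGDA

namespace DSGDA

/-- Consequences of the parameter conditions that do not involve `β`; here `K = λ L`. -/
structure StepBounds (L K r₁ r₂ c α μ σ D : ℝ) : Prop where
  L_pos : 0 < L
  K_pos : 0 < K
  r₁_ge : 2 * L ≤ r₁
  r₂_ge : 2 * K ≤ r₂
  c_pos : 0 < c
  c_le : c * (L + r₁) ≤ 4 / 3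
  cK_le : c * K ≤ 1 / 6
  α_pos : 0 < α
  σ_pos : 0 < σ
  ασ_le : α * (K * σ ^ 2) ≤ 2 / 3
  αD_le : α * D ≤ 1 / 6
  μ_pos : 0 < μ
  μ_lt_one : μ < 1
  μ_le : r₂ * μ ≤ α * K ^ 2 / 320
  le_σ : 1 + c * (L + r₁) ≤ σ * (c * (r₁ - L))
  le_D : K ^ 2 / (r₁ - L) + K + r₂ ≤ D
  le_D' : 2 * K + r₂ ≤ D

lemma ParamBounds.stepBounds {L lam r₁ r₂ c α μ : ℝ} (hL : 0 < L) (hlam : 0 < lam)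
    (h : ParamBounds L lam r₁ r₂ c α μ) :
    StepBounds L (lam * L) r₁ r₂ c α μ (sigma L r₁ c) (Ld L lam r₁ r₂) := by
  have hK : 0 < lam * L := mul_pos hlam hL
  have hr1 := h.r₁_ge
  have hr2 := h.r₂_ge
  have hc := h.c_pos
  have hα := h.α_pos
  have hm : 0 < r₁ - L := by linarith
  have hσ : 0 < sigma L r₁ c :=
    div_pos (by nlinarith [mul_pos hc (by linarith : 0 < r₁)]) (mul_pos hc hm)
  have hD : 0 < Ld L lam r₁ r₂ := by
    have : 0 < lam * L / (r₁ - L) := div_pos hK hm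
    unfold Ld
    nlinarith [mul_pos this hK]
  have c1 := h.c_le.trans (min_le_left _ _)
  have c2 := h.c_le.trans (min_le_right _ _)
  have a1 := h.α_le.trans (min_le_left _ _)
  have a2 := h.α_le.trans ((min_le_right _ _).trans (min_le_left _ _))
  have m1 := h.μ_le.trans (min_le_right _ _)
  rw [le_div_iff₀ (by positivity)] at a2
  rw [le_div_iff₀ (by nlinarith)] at c1 c2
  rw [le_div_iff₀ (by positivity)] at a1
  rw [le_div_iff₀ (by nlinarith)] at m1
  have h5 : r₂ * μ * 320 ≤ μ * (64 * r₂ * (lam + 5)) := by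
    have : 0 ≤ r₂ * μ * lam := mul_nonneg (mul_nonneg (by linarith) h.μ_pos.le) hlam.le
    linarith
  refine ⟨hL, hK, hr1, by linarith, hc, by linarith, by linarith, hα, hσ, by linarith,
    by linarith, h.μ_pos, h.μ_lt_one, by nlinarith, ?_, ?_, ?_⟩
  · have : sigma L r₁ c * (c * (r₁ - L)) = 2 * c * r₁ + 1 := by
      unfold sigma
      field_simp
    rw [this]
    nlinarith
  · have : (lam * L) ^ 2 / (r₁ - L) = lam * L / (r₁ - L) * (lam * L) := by ring
    unfold Ld
    linarith
  · have : 0 < lam * L / (r₁ - L) * (lam * L) := mul_pos (div_pos hK hm) hK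
    unfold Ld
    linarith

lemma BetaBounds.le_fifteenth {L lam r₁ α β : ℝ} (hlam : 0 < lam) (hr : 0 < r₁)
    (h : BetaBounds L lam r₁ α β) : β ≤ 1 / 15 := by
  have h1 := h.β_le.trans (min_le_left _ _)
  refine h1.trans ?_
  rw [div_le_div_iff₀ (by positivity) (by norm_num)]
  nlinarith [sq_nonneg (2 * lam * L + 5 * r₁), mul_pos (pow_pos hr 2) hlam]

lemma BetaBounds.mul_le {L lam r₁ α β : ℝ} (hlam : 0 < lam) (hr : 0 < r₁)
    (h : BetaBounds L lam r₁ α β) : r₁ * β ≤ α * (lam * L) ^ 2 / 1920 := by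
  have h1 := h.β_le.trans (min_le_right _ _)
  rw [le_div_iff₀ (by positivity)] at h1
  have h2 : 5 ≤ (lam + 5) * (lam + 1) ^ 2 := by nlinarith [pow_pos hlam 2, pow_pos hlam 3]
  have h3 : r₁ * β * 5 ≤ r₁ * β * ((lam + 5) * (lam + 1) ^ 2) :=
    mul_le_mul_of_nonneg_left h2 (mul_nonneg hr.le h.β_pos.le)
  nlinarith

lemma StepBounds.descent {L K r₁ r₂ c α μ σ D β : ℝ} (h : StepBounds L K r₁ r₂ c α μ σ D)
    (hβ : 0 < β) (hβ15 : β ≤ 1 / 15) (hβr : r₁ * β ≤ α * K ^ 2 / 1920)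
    {X Y Z V q w e Δ : ℝ} (hY : 0 ≤ Y) (hq0 : 0 ≤ q) (hw0 : 0 ≤ w)
    (hq : α * (r₂ - K) * q ≤ (1 + α * D) * Y + α * K * σ * X) (hw : μ * w ≤ V + μ * q)
    (hΔ : (1 / c - (L + r₁) / 2) * X ^ 2 + (1 / α - D) * Y ^ 2 - 2 * K * σ * X * Y
      + (2 - β) / (2 * β) * r₁ * Z ^ 2 + (2 - μ) / (2 * μ) * r₂ * V ^ 2
      - 2 * r₁ * Z * (e + q + 2 * Z) ≤ Δ) :
    X ^ 2 / (24 * c) + Y ^ 2 / (24 * α) + r₁ * Z ^ 2 / (16 * β) + r₂ * V ^ 2 / (8 * μ)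
      ≤ Δ + 2 * r₁ * β * e ^ 2 - r₂ * μ / 16 * w ^ 2 := by
  obtain ⟨hL, hK, hr1, hr2, hc, hc1, hc2, hα, hσ, hασ, hαD, hμ, hμ1, hμr, -, -, -⟩ := h
  have hr1p : 0 < r₁ := by linarith
  have hr2p : 0 < r₂ := by linarith
  -- the terms in `X`, `Y`
  have x1 : (L + r₁) * X ^ 2 ≤ 4 / 3 * (X ^ 2 / c) := by
    rw [← mul_div_assoc, le_div_iff₀ hc]
    linarith [mul_le_mul_of_nonneg_right hc1 (sq_nonneg X)]
  have x2 : K * X ^ 2 ≤ 1 / 6 * (X ^ 2 / c) := by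
    rw [← mul_div_assoc, le_div_iff₀ hc]
    linarith [mul_le_mul_of_nonneg_right hc2 (sq_nonneg X)]
  have y1 : D * Y ^ 2 ≤ 1 / 6 * (Y ^ 2 / α) := by
    rw [← mul_div_assoc, le_div_iff₀ hα]
    linarith [mul_le_mul_of_nonneg_right hαD (sq_nonneg Y)]
  have y2 : K * σ ^ 2 * Y ^ 2 ≤ 2 / 3 * (Y ^ 2 / α) := by
    rw [← mul_div_assoc, le_div_iff₀ hα]
    linarith [mul_le_mul_of_nonneg_right hασ (sq_nonneg Y)]
  have xy : 2 * K * σ * X * Y ≤ K * X ^ 2 + K * σ ^ 2 * Y ^ 2 := by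
    linarith [mul_nonneg hK.le (sq_nonneg (X - σ * Y))]
  -- the term in `q`
  have q1 : α * K * q ≤ 7 / 6 * Y + α * K * σ * X := by
    have : α * K * q ≤ α * (r₂ - K) * q :=
      mul_le_mul_of_nonneg_right (mul_le_mul_of_nonneg_left (by linarith) hα.le) hq0
    linarith [mul_le_mul_of_nonneg_right hαD hY]
  have q2 : (α * K * q) ^ 2 ≤ 49 / 18 * Y ^ 2 + 2 * (α * K * σ * X) ^ 2 := by
    have := pow_le_pow_left₀ (by positivity) q1 2
    linarith [sq_nonneg (7 / 6 * Y - α * K * σ * X)]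
  have q3 : α * K ^ 2 * q ^ 2 ≤ 49 / 18 * (Y ^ 2 / α) + 2 / 9 * (X ^ 2 / c) := by
    have e1 : α * K ^ 2 * q ^ 2 = (α * K * q) ^ 2 / α := by field_simp
    have e2 : (49 / 18 * Y ^ 2 + 2 * (α * K * σ * X) ^ 2) / α
        = 49 / 18 * (Y ^ 2 / α) + 2 * (α * (K * σ ^ 2)) * (K * X ^ 2) := by field_simp
    have e3 : α * (K * σ ^ 2) * (K * X ^ 2) ≤ 2 / 3 * (K * X ^ 2) :=
      mul_le_mul_of_nonneg_right hασ (by positivity)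
    have := div_le_div_of_nonneg_right q2 hα.le
    linarith
  have q4 : (16 * (r₁ * β) + r₂ * μ / 8) * q ^ 2 ≤ 1 / 100 * (α * K ^ 2 * q ^ 2) := by
    have : 16 * (r₁ * β) + r₂ * μ / 8 ≤ 1 / 100 * (α * K ^ 2) := by
      linarith [mul_nonneg hα.le (sq_nonneg K)]
    linarith [mul_le_mul_of_nonneg_right this (sq_nonneg q)]
  -- the terms in `Z`
  have z1 : (2 - β) / (2 * β) * r₁ * Z ^ 2 = r₁ * Z ^ 2 / β - r₁ * Z ^ 2 / 2 := by
    field_simp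
  have z2 : r₁ * Z ^ 2 ≤ 1 / 15 * (r₁ * Z ^ 2 / β) := by
    rw [← mul_div_assoc, le_div_iff₀ hβ]
    linarith [mul_le_mul_of_nonneg_left hβ15 (mul_nonneg hr1p.le (sq_nonneg Z))]
  have z3 : 2 * r₁ * Z * e ≤ r₁ * Z ^ 2 / β / 2 + 2 * r₁ * β * e ^ 2 := by
    have : 0 ≤ r₁ / (2 * β) * (Z - 2 * β * e) ^ 2 := by positivity
    have e1 : r₁ / (2 * β) * (Z - 2 * β * e) ^ 2
        = r₁ * Z ^ 2 / β / 2 + 2 * r₁ * β * e ^ 2 - 2 * r₁ * Z * e := by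
      field_simp
      ring
    linarith
  have z4 : 2 * r₁ * Z * q ≤ r₁ * Z ^ 2 / β / 16 + 16 * (r₁ * β) * q ^ 2 := by
    have : 0 ≤ r₁ / (16 * β) * (Z - 16 * β * q) ^ 2 := by positivity
    have e1 : r₁ / (16 * β) * (Z - 16 * β * q) ^ 2
        = r₁ * Z ^ 2 / β / 16 + 16 * (r₁ * β) * q ^ 2 - 2 * r₁ * Z * q := by
      field_simp
      ring
    linarith
  have zn : 0 ≤ r₁ * Z ^ 2 / β := by positivity
  -- the terms in `V`
  have v1 : (2 - μ) / (2 * μ) * r₂ * V ^ 2 = r₂ * V ^ 2 / μ - r₂ * V ^ 2 / 2 := by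
    field_simp
  have v2 : r₂ * V ^ 2 ≤ r₂ * V ^ 2 / μ := by
    rw [le_div_iff₀ hμ]
    linarith [mul_le_mul_of_nonneg_left hμ1.le (mul_nonneg hr2p.le (sq_nonneg V))]
  have v3 : r₂ * μ / 16 * w ^ 2 ≤ r₂ * V ^ 2 / μ / 8 + r₂ * μ / 8 * q ^ 2 := by
    have h1 : (μ * w) ^ 2 ≤ 2 * V ^ 2 + 2 * (μ * q) ^ 2 := by
      have := pow_le_pow_left₀ (mul_nonneg hμ.le hw0) hw 2
      linarith [sq_nonneg (V - μ * q)]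
    have h2 : r₂ * μ / 16 * w ^ 2 = r₂ / (16 * μ) * (μ * w) ^ 2 := by field_simp
    have h3 : r₂ * V ^ 2 / μ / 8 + r₂ * μ / 8 * q ^ 2
        = r₂ / (16 * μ) * (2 * V ^ 2 + 2 * (μ * q) ^ 2) := by
      field_simp
      ring
    rw [h2, h3]
    exact mul_le_mul_of_nonneg_left h1 (by positivity)
  have vn : 0 ≤ r₂ * V ^ 2 / μ := by positivity
  have xn : 0 ≤ X ^ 2 / c := by positivity
  have yn : 0 ≤ Y ^ 2 / α := by positivity
  have g1 : X ^ 2 / (24 * c) = X ^ 2 / c / 24 := by field_simp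
  have g2 : Y ^ 2 / (24 * α) = Y ^ 2 / α / 24 := by field_simp
  have g3 : r₁ * Z ^ 2 / (16 * β) = r₁ * Z ^ 2 / β / 16 := by field_simp
  have g4 : r₂ * V ^ 2 / (8 * μ) = r₂ * V ^ 2 / μ / 8 := by field_simp
  have g5 : (1 / c - (L + r₁) / 2) * X ^ 2 = X ^ 2 / c - (L + r₁) * X ^ 2 / 2 := by ring
  have g6 : (1 / α - D) * Y ^ 2 = Y ^ 2 / α - D * Y ^ 2 := by ring
  have g7 : 2 * r₁ * Z * (e + q + 2 * Z) = 2 * r₁ * Z * e + 2 * r₁ * Z * q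
    + 4 * (r₁ * Z ^ 2) := by ring
  rw [g1, g2, g3, g4]
  rw [g5, g6, z1, v1, g7] at hΔ
  linarith

end DSGDA

namespace DSGDA

variable {n d : ℕ} {f : E n → E d → ℝ} {X : Set (E n)} {Y : Set (E d)}
  {L K r₁ r₂ c α μ σ D β : ℝ}

/-- The Lyapunov function `F - 2 d + 2 P`, where the dual function `d` is evaluated at an inner
minimizer `u` and the Moreau envelope `P` at a proximal point `p`. -/
noncomputable def potential (f : E n → E d → ℝ) (Y : Set (E d)) (r₁ r₂ : ℝ) (x : E n) (y : E d) (z : E n)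
    (v : E d) (u p : E n) : ℝ :=
  regF f r₁ r₂ z v x y - 2 * regF f r₁ r₂ z v u y + 2 * (maxY f Y p + r₁ / 2 * ‖p - z‖ ^ 2)

lemma primal_step_le (hf : LipschitzGrad f X Y L K) (hX : Convex ℝ X) (hc : 0 < c)
    {x x' z : E n} {y : E d} (hx : x ∈ X) (hy : y ∈ Y)
    (hx' : IsProj X (x - c • (gradX f x y + r₁ • (x - z))) x') :
    f x' y + r₁ / 2 * ‖x' - z‖ ^ 2 + (1 / c - (L + r₁) / 2) * ‖x' - x‖ ^ 2
      ≤ f x y + r₁ / 2 * ‖x - z‖ ^ 2 := by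
  have h1 := hf.le_quadratic_x hX hx hx'.1 hy
  have h2 := hx'.inner_le_zero hX hx
  have h3 := norm_sub_sq_expand x' x z
  have h4 : ⟪x - c • (gradX f x y + r₁ • (x - z)) - x', x - x'⟫_ℝ
      = ‖x' - x‖ ^ 2 + c * (⟪gradX f x y, x' - x⟫_ℝ + r₁ * ⟪x - z, x' - x⟫_ℝ) := by
    rw [← neg_sub x' x, inner_neg_right, ← real_inner_self_eq_norm_sq]
    simp only [inner_sub_left, inner_add_left, real_inner_smul_left]
    ring
  rw [h4] at h2
  have h5 : 1 / c * ‖x' - x‖ ^ 2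
      ≤ -(⟪gradX f x y, x' - x⟫_ℝ + r₁ * ⟪x - z, x' - x⟫_ℝ) := by
    rw [one_div_mul_eq_div, div_le_iff₀ hc]
    linarith
  rw [h3]
  linarith

lemma dual_step_le (hf : LipschitzGrad f X Y L K) (hY : Convex ℝ Y) (hr₂ : K ≤ r₂)
    {x : E n} {y y' v : E d} (hx : x ∈ X) (hy : y ∈ Y) (hy' : y' ∈ Y) :
    f x y' - r₂ / 2 * ‖y' - v‖ ^ 2 ≤ f x y - r₂ / 2 * ‖y - v‖ ^ 2
      + ⟪gradY f x y - r₂ • (y - v), y' - y⟫_ℝ := by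
  have h1 := hf.le_quadratic_y hY hx hy hy'
  have h3 := norm_sub_sq_expand y' y v
  rw [h3, inner_sub_left (gradY f x y), real_inner_smul_left]
  nlinarith [mul_nonneg (sub_nonneg.2 hr₂) (sq_nonneg ‖y' - y‖)]

lemma norm_sq_le_of_isProj_ascent (hY : Convex ℝ Y) (hα : 0 < α) {y y' g : E d} (hy : y ∈ Y)
    (hy' : IsProj Y (y + α • g) y') : 1 / α * ‖y' - y‖ ^ 2 ≤ ⟪g, y' - y⟫_ℝ := by
  have h2 := hy'.inner_le_zero hY hy
  have h4 : ⟪y + α • g - y', y - y'⟫_ℝ = ‖y' - y‖ ^ 2 - α * ⟪g, y' - y⟫_ℝ := by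
    rw [← neg_sub y' y, inner_neg_right, ← real_inner_self_eq_norm_sq]
    simp only [inner_sub_left, inner_add_left, real_inner_smul_left]
    ring
  rw [one_div_mul_eq_div, div_le_iff₀ hα]
  linarith

lemma extrapolation_sq {x z z' : E n} (hz : z' = z + β • (x - z)) (r : ℝ) :
    r / 2 * ‖x - z‖ ^ 2 - r / 2 * ‖x - z'‖ ^ 2 = (2 - β) / (2 * β) * r * ‖z' - z‖ ^ 2 := by
  have h1 : x - z' = (1 - β) • (x - z) := by rw [hz]; module
  have h2 : z' - z = β • (x - z) := by rw [hz]; module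
  rw [h1, h2, norm_smul, norm_smul, mul_pow, mul_pow, Real.norm_eq_abs, Real.norm_eq_abs,
    sq_abs, sq_abs]
  field_simp
  ring

/-- One-step decrease of the potential, in terms of the distance of the proximal point to a saddle
point. -/
lemma potential_sub_ge (hf : LipschitzGrad f X Y L K) (hX : Convex ℝ X) (hY : Convex ℝ Y)
    (h : StepBounds L K r₁ r₂ c α μ σ D)
    {x x' z z' : E n} {y y' v v' : E d} (hx : x ∈ X) (hy : y ∈ Y)
    (hx' : IsProj X (x - c • (gradX f x y + r₁ • (x - z))) x')
    (hy' : IsProj Y (y + α • (gradY f x' y - r₂ • (y - v))) y')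
    (hz' : z' = z + β • (x' - z)) (hv' : v' = v + μ • (y' - v))
    {u u' u'' : E n} (hu : IsInner f X r₁ y z u) (hu' : IsInner f X r₁ y' z u')
    (hu'' : IsInner f X r₁ y' z' u'')
    {p p' : E n} (hp : IsProx f X Y r₁ z p) (hp' : IsProx f X Y r₁ z' p')
    {xb : E n} {yb : E d} (hb : IsSaddle f X Y r₁ r₂ z v xb yb) :
    (1 / c - (L + r₁) / 2) * ‖x' - x‖ ^ 2 + (1 / α - D) * ‖y' - y‖ ^ 2
      - 2 * K * σ * ‖x' - x‖ * ‖y' - y‖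
      + (2 - β) / (2 * β) * r₁ * ‖z' - z‖ ^ 2 + (2 - μ) / (2 * μ) * r₂ * ‖v' - v‖ ^ 2
      - 2 * r₁ * ‖z' - z‖ * (‖p - xb‖ + ‖y' - yb‖ + 2 * ‖z' - z‖)
      ≤ potential f Y r₁ r₂ x y z v u p - potential f Y r₁ r₂ x' y' z' v' u'' p' := by
  have hL := h.L_pos
  have hr1 := h.r₁_ge
  have hr2 := h.r₂_ge
  have hK := h.K_pos
  have hm : 0 < r₁ - L := by linarith
  have a1 := primal_step_le hf hX h.c_pos hx hy hx'
  have a2 := dual_step_le (v := v) hf hY (by linarith : K ≤ r₂) hx'.1 hy hy'.1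
  have a3 := norm_sq_le_of_isProj_ascent hY h.α_pos hy hy'
  have a4 := extrapolation_sq hz' r₁
  have a5 := extrapolation_sq hv' r₂
  have a6 := hu.ascent hf hX hY (by linarith) hy hy'.1 hu'
  have a7 := norm_sub_sq_expand y' y v
  have a8 := hu'.2 u'' hu''.1
  have a9 := norm_sub_sq_diff u'' z z'
  have a10 := hp'.2 p hp.1
  have a11 := norm_sub_sq_diff p z z'
  have a12 : ‖x' - u‖ ≤ σ * ‖x' - x‖ := by
    have h1 := hu.dist_le_of_isProj hf hX hL.le (by linarith) h.c_pos.le hy hx hx'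
    have h2 := mul_le_mul_of_nonneg_right h.le_σ (norm_nonneg (x' - x))
    refine le_of_mul_le_mul_left ?_ (mul_pos h.c_pos hm)
    linarith
  have a13 : |⟪gradY f u y - gradY f x' y, y' - y⟫_ℝ| ≤ K * σ * ‖x' - x‖ * ‖y' - y‖ := by
    refine (abs_real_inner_le_norm _ _).trans
      (mul_le_mul_of_nonneg_right ?_ (norm_nonneg _))
    have := hf.lipY u hu.1 x' hx'.1 y hy y hy
    rw [sub_self, norm_zero, add_zero, norm_sub_rev u] at this
    linarith [mul_le_mul_of_nonneg_left a12 hK.le]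
  have a14 := mul_le_mul_of_nonneg_right h.le_D (sq_nonneg ‖y' - y‖)
  have b1 : ‖xb - u'‖ ≤ ‖y' - yb‖ := by
    have h1 := hb.inner.dist_le hf hX hL.le (by linarith) hb.mem hy'.1 hu'
    rw [sub_self, norm_zero, mul_zero, add_zero, norm_sub_rev yb] at h1
    refine le_of_mul_le_mul_left (h1.trans ?_) hm
    exact mul_le_mul_of_nonneg_right (by linarith) (norm_nonneg _)
  have b2 : ‖u' - u''‖ ≤ 2 * ‖z' - z‖ := by
    have h1 := hu'.dist_le hf hX hL.le (by linarith) hy'.1 hy'.1 hu''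
    rw [sub_self, norm_zero, mul_zero, zero_add, norm_sub_rev z] at h1
    refine le_of_mul_le_mul_left (h1.trans ?_) hm
    linarith [mul_nonneg (sub_nonneg.2 hr1) (norm_nonneg (z' - z))]
  have b3 : ‖p - u''‖ ≤ ‖p - xb‖ + ‖y' - yb‖ + 2 * ‖z' - z‖ := by
    have e : p - u'' = (p - xb) + (xb - u') + (u' - u'') := by abel
    rw [e]
    linarith [norm_add₃_le (a := p - xb) (b := xb - u') (c := u' - u'')]
  have b4 : ⟪z' - z, z' + z - (2 : ℝ) • u''⟫_ℝ - ⟪z' - z, z' + z - (2 : ℝ) • p⟫_ℝ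
      = 2 * ⟪z' - z, p - u''⟫_ℝ := by
    simp only [inner_sub_right, inner_smul_right]
    ring
  have b5 : -(‖z' - z‖ * (‖p - xb‖ + ‖y' - yb‖ + 2 * ‖z' - z‖)) ≤ ⟪z' - z, p - u''⟫_ℝ := by
    have h1 := (abs_le.1 (abs_real_inner_le_norm (z' - z) (p - u''))).1
    have h2 := mul_le_mul_of_nonneg_left b3 (norm_nonneg (z' - z))
    linarith
  have b6 := mul_le_mul_of_nonneg_left b5 (by linarith : 0 ≤ 2 * r₁)
  have b7 := (abs_le.1 a13).1
  rw [inner_sub_left] at b7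
  rw [inner_sub_left (gradY f x' y), real_inner_smul_left] at a2 a3
  unfold potential regF
  have e1 : r₁ / 2 * ‖u'' - z'‖ ^ 2 - r₁ / 2 * ‖u'' - z‖ ^ 2 - r₁ / 2 * ‖p - z'‖ ^ 2
      + r₁ / 2 * ‖p - z‖ ^ 2 = r₁ * ⟪z' - z, p - u''⟫_ℝ := by
    linear_combination r₁ / 2 * a9 - r₁ / 2 * a11 + r₁ / 2 * b4
  rw [a7] at a2 a5
  rw [sub_mul (1 / α)]
  linarith only [a1, a2, a3, a4, a5, a6, a8, a10, a14, b6, b7, e1]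

end DSGDA

namespace DSGDA

variable {n d : ℕ} {f : E n → E d → ℝ} {X : Set (E n)} {Y : Set (E d)}
  {L K r₁ r₂ c α μ σ D β : ℝ}

lemma statDist_x_le (hf : LipschitzGrad f X Y L K) (hX : Convex ℝ X) (hr : 0 ≤ r₁)
    (hc : 0 < c) {x x' z : E n} {y y' : E d} (hx : x ∈ X) (hy : y ∈ Y) (hy' : y' ∈ Y)
    (hx' : IsProj X (x - c • (gradX f x y + r₁ • (x - z))) x') :
    statDist X (gradX f x' y') x'
      ≤ (L + 1 / c + r₁) * ‖x' - x‖ + L * ‖y' - y‖ + r₁ * ‖x' - z‖ := by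
  set g := gradX f x y + r₁ • (x - z) with hg
  refine (statDist_le (ξ := (1 / c) • (x - x') - g) hx'.1 fun w hw => ?_).trans ?_
  · have h1 := hx'.inner_le_zero hX hw
    have e : (1 / c) • (x - x') - g = (1 / c) • (x - c • g - x') := by
      rw [smul_sub, smul_sub, smul_sub, smul_smul, one_div_mul_cancel hc.ne', one_smul]
      abel
    rw [e, real_inner_smul_left]
    exact mul_nonpos_of_nonneg_of_nonpos (by positivity) h1
  · have e : gradX f x' y' + ((1 / c) • (x - x') - g)
        = (gradX f x' y' - gradX f x y) + (1 / c) • (x - x') + r₁ • ((x' - x) - (x' - z)) := by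
      rw [hg]
      module
    have h1 := hf.lipX x' hx'.1 x hx y' hy' y hy
    have h2 : ‖(1 / c) • (x - x')‖ = 1 / c * ‖x' - x‖ := by
      rw [norm_smul, Real.norm_of_nonneg (by positivity), norm_sub_rev]
    have h3 : ‖r₁ • ((x' - x) - (x' - z))‖ ≤ r₁ * (‖x' - x‖ + ‖x' - z‖) := by
      rw [norm_smul, Real.norm_of_nonneg hr]
      exact mul_le_mul_of_nonneg_left (norm_sub_le _ _) hr
    rw [e]
    have := norm_add₃_le (a := gradX f x' y' - gradX f x y) (b := (1 / c) • (x - x'))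
      (c := r₁ • ((x' - x) - (x' - z)))
    linarith

lemma statDist_y_le (hf : LipschitzGrad f X Y L K) (hY : Convex ℝ Y) (hr : 0 ≤ r₂)
    (hα : 0 < α) {x' : E n} {y y' v : E d} (hx' : x' ∈ X) (hy : y ∈ Y)
    (hy' : IsProj Y (y + α • (gradY f x' y - r₂ • (y - v))) y') :
    statDist Y (-gradY f x' y') y'
      ≤ (K + 1 / α + r₂) * ‖y' - y‖ + r₂ * ‖y' - v‖ := by
  set g := gradY f x' y - r₂ • (y - v) with hg
  refine (statDist_le (ξ := (1 / α) • (y - y') + g) hy'.1 fun w hw => ?_).trans ?_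
  · have h1 := hy'.inner_le_zero hY hw
    have e : (1 / α) • (y - y') + g = (1 / α) • (y + α • g - y') := by
      rw [smul_sub, smul_sub, smul_add, smul_smul, one_div_mul_cancel hα.ne', one_smul]
      abel
    rw [e, real_inner_smul_left]
    exact mul_nonpos_of_nonneg_of_nonpos (by positivity) h1
  · have e : -gradY f x' y' + ((1 / α) • (y - y') + g)
        = -(gradY f x' y' - gradY f x' y) + (1 / α) • (y - y')
          + r₂ • ((y' - y) - (y' - v)) := by
      rw [hg]
      module
    have h1 := hf.lipY x' hx' x' hx' y' hy'.1 y hy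
    rw [sub_self, norm_zero, zero_add, ← norm_neg] at h1
    have h2 : ‖(1 / α) • (y - y')‖ = 1 / α * ‖y' - y‖ := by
      rw [norm_smul, Real.norm_of_nonneg (by positivity), norm_sub_rev]
    have h3 : ‖r₂ • ((y' - y) - (y' - v))‖ ≤ r₂ * (‖y' - y‖ + ‖y' - v‖) := by
      rw [norm_smul, Real.norm_of_nonneg hr]
      exact mul_le_mul_of_nonneg_left (norm_sub_le _ _) hr
    rw [e]
    have := norm_add₃_le (a := -(gradY f x' y' - gradY f x' y)) (b := (1 / α) • (y - y'))
      (c := r₂ • ((y' - y) - (y' - v)))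
    linarith

lemma maxY_le (hYne : Y.Nonempty) {x : E n} {B : ℝ} (h : ∀ y ∈ Y, f x y ≤ B) : maxY f Y x ≤ B :=
  csSup_le (hYne.image _) (by rintro _ ⟨y, hy, rfl⟩; exact h y hy)

lemma neg_le_potential (hf : LipschitzGrad f X Y L K) (hYc : IsCompact Y) (hr₁ : 0 ≤ r₁)
    (hr₂ : 0 ≤ r₂) {B : ℝ} (hB : ∀ x ∈ X, ∀ y ∈ Y, |f x y| ≤ B) {x z u p : E n} {y v : E d}
    (hx : x ∈ X) (hy : y ∈ Y) (hu : IsInner f X r₁ y z u) (hp : IsProx f X Y r₁ z p) :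
    -B ≤ potential f Y r₁ r₂ x y z v u p := by
  have h1 := hu.2 x hx
  have h2 := hu.2 p hp.1
  have h3 := hf.le_maxY hYc p hy
  have h4 := (abs_le.1 (hB p hp.1 y hy)).1
  have h5 : 0 ≤ r₁ / 2 * ‖p - z‖ ^ 2 := by positivity
  have h6 : 0 ≤ r₂ / 2 * ‖y - v‖ ^ 2 := by positivity
  unfold potential regF
  linarith

lemma potential_le (hYne : Y.Nonempty) (hr₁ : 0 ≤ r₁) (hr₂ : 0 ≤ r₂) {B R : ℝ}
    (hB : ∀ x ∈ X, ∀ y ∈ Y, |f x y| ≤ B) {x z u p : E n} {y v : E d}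
    (hx : x ∈ X) (hy : y ∈ Y) (hu : u ∈ X) (hp : IsProx f X Y r₁ z p)
    (hxz : ‖x - z‖ ≤ R) (hyv : ‖y - v‖ ≤ R) :
    potential f Y r₁ r₂ x y z v u p ≤ 5 * B + 3 / 2 * r₁ * R ^ 2 + r₂ * R ^ 2 := by
  have h1 := hp.2 x hx
  have h2 := (abs_le.1 (hB u hu y hy)).1
  have h3 := (abs_le.1 (hB x hx y hy)).2
  have h4 := maxY_le hYne fun y' hy' => (abs_le.1 (hB x hx y' hy')).2
  have h5 : r₁ * ‖x - z‖ ^ 2 ≤ r₁ * R ^ 2 :=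
    mul_le_mul_of_nonneg_left (pow_le_pow_left₀ (norm_nonneg _) hxz 2) hr₁
  have h6 : r₂ * ‖y - v‖ ^ 2 ≤ r₂ * R ^ 2 :=
    mul_le_mul_of_nonneg_left (pow_le_pow_left₀ (norm_nonneg _) hyv 2) hr₂
  have h7 : 0 ≤ r₂ * ‖y - v‖ ^ 2 := by positivity
  have h8 : 0 ≤ r₁ * ‖u - z‖ ^ 2 := by positivity
  unfold potential regF
  linarith

/-- One step of the algorithm from a feasible point: decrease of the potential up to the duality
gap at a saddle point, and control of the distance to that saddle point. -/
lemma step_estimates (hf : LipschitzGrad f X Y L K) (hX : Convex ℝ X) (hY : Convex ℝ Y)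
    (hYc : IsCompact Y) (h : StepBounds L K r₁ r₂ c α μ σ D) (hβ : 0 < β) (hβ15 : β ≤ 1 / 15)
    (hβr : r₁ * β ≤ α * K ^ 2 / 1920)
    {x x' z z' : E n} {y y' v v' : E d} (hx : x ∈ X) (hy : y ∈ Y)
    (hx' : IsProj X (x - c • (gradX f x y + r₁ • (x - z))) x')
    (hy' : IsProj Y (y + α • (gradY f x' y - r₂ • (y - v))) y')
    (hz' : z' = z + β • (x' - z)) (hv' : v' = v + μ • (y' - v))
    {u u' u'' : E n} (hu : IsInner f X r₁ y z u) (hu' : IsInner f X r₁ y' z u')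
    (hu'' : IsInner f X r₁ y' z' u'')
    {p p' : E n} (hp : IsProx f X Y r₁ z p) (hp' : IsProx f X Y r₁ z' p')
    {xb : E n} {yb : E d} (hb : IsSaddle f X Y r₁ r₂ z v xb yb) :
    (‖x' - x‖ ^ 2 / (24 * c) + ‖y' - y‖ ^ 2 / (24 * α) + r₁ * ‖z' - z‖ ^ 2 / (16 * β)
        + r₂ * ‖v' - v‖ ^ 2 / (8 * μ)
      ≤ potential f Y r₁ r₂ x y z v u p - potential f Y r₁ r₂ x' y' z' v' u'' p'
        + (4 * r₁ / (r₁ - L) * β * (maxY f Y xb - f xb yb) - r₂ * μ / 16 * ‖yb - v‖ ^ 2)) ∧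
    α * (r₂ - K) * ‖y' - yb‖ ≤ (1 + α * D) * ‖y' - y‖ + α * K * σ * ‖x' - x‖ ∧
    μ * ‖yb - v‖ ≤ ‖v' - v‖ + μ * ‖y' - yb‖ ∧
    ‖p' - z'‖ ≤ ‖p' - xb‖ + ‖y' - yb‖ + (σ * ‖x' - x‖ + ‖y' - y‖) + ‖x' - z‖ := by
  have hL := h.L_pos
  have hr1 := h.r₁_ge
  have hr2 := h.r₂_ge
  have hK := h.K_pos
  have hα := h.α_pos
  have hm : 0 < r₁ - L := by linarith
  have hr1p : 0 < r₁ := by linarith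
  have s1 : ‖x' - u‖ ≤ σ * ‖x' - x‖ := by
    have h1 := hu.dist_le_of_isProj hf hX hL.le hr1p.le h.c_pos.le hy hx hx'
    have h2 := mul_le_mul_of_nonneg_right h.le_σ (norm_nonneg (x' - x))
    refine le_of_mul_le_mul_left ?_ (mul_pos h.c_pos hm)
    linarith
  have s2 : ‖u - u'‖ ≤ ‖y' - y‖ := by
    have h1 := hu.dist_le hf hX hL.le hr1p.le hy hy'.1 hu'
    rw [sub_self, norm_zero, mul_zero, add_zero, norm_sub_rev y] at h1
    refine le_of_mul_le_mul_left (h1.trans ?_) hm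
    exact mul_le_mul_of_nonneg_right (by linarith) (norm_nonneg _)
  have s3 : ‖xb - u'‖ ≤ ‖y' - yb‖ := by
    have h1 := hb.inner.dist_le hf hX hL.le hr1p.le hb.mem hy'.1 hu'
    rw [sub_self, norm_zero, mul_zero, add_zero, norm_sub_rev yb] at h1
    refine le_of_mul_le_mul_left (h1.trans ?_) hm
    exact mul_le_mul_of_nonneg_right (by linarith) (norm_nonneg _)
  have s4 : ‖x' - u'‖ ≤ σ * ‖x' - x‖ + ‖y' - y‖ := by
    have := norm_add_le (x' - u) (u - u')
    rw [sub_add_sub_cancel] at this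
    linarith
  have hq : α * (r₂ - K) * ‖y' - yb‖ ≤ (1 + α * D) * ‖y' - y‖ + α * K * σ * ‖x' - x‖ := by
    have h1 := hb.dist_le_of_isProj hf hY hα.le hK.le (by linarith) hx'.1 hy hu' hy'
    have h2 := mul_le_mul_of_nonneg_left s4 (mul_pos hα hK).le
    have h3 := mul_le_mul_of_nonneg_left h.le_D' (mul_nonneg hα.le (norm_nonneg (y' - y)))
    linarith
  have hw : μ * ‖yb - v‖ ≤ ‖v' - v‖ + μ * ‖y' - yb‖ := by
    have e : ‖v' - v‖ = μ * ‖y' - v‖ := by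
      rw [hv', add_sub_cancel_left, norm_smul, Real.norm_of_nonneg h.μ_pos.le]
    have h1 := norm_sub_le (y' - v) (y' - yb)
    rw [sub_sub_sub_cancel_left] at h1
    rw [e]
    linarith [mul_le_mul_of_nonneg_left h1 h.μ_pos.le]
  refine ⟨?_, hq, hw, ?_⟩
  · have h1 := h.descent hβ hβ15 hβr (norm_nonneg _) (norm_nonneg _) (norm_nonneg _) hq hw
      (potential_sub_ge (β := β) hf hX hY h hx hy hx' hy' hz' hv' hu hu' hu'' hp hp' hb)
    have h2 := hb.dist_isProx_le hf hX hYc hr1p.le hp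
    rw [sub_self, norm_zero, mul_zero, zero_mul, add_zero] at h2
    have h3 : 2 * r₁ * β * ‖p - xb‖ ^ 2
        ≤ 4 * r₁ / (r₁ - L) * β * (maxY f Y xb - f xb yb) := by
      have e : 2 * r₁ * β * ‖p - xb‖ ^ 2
          = 4 * r₁ / (r₁ - L) * β * ((r₁ - L) / 2 * ‖p - xb‖ ^ 2) := by
        field_simp
        ring
      rw [e]
      exact mul_le_mul_of_nonneg_left h2 (by positivity)
    linarith
  · have e1 : x' - z' = (1 - β) • (x' - z) := by rw [hz']; module
    have e2 : ‖x' - z'‖ ≤ ‖x' - z‖ := by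
      rw [e1, norm_smul, Real.norm_of_nonneg (by linarith)]
      nlinarith [norm_nonneg (x' - z)]
    have e3 : p' - z' = (p' - xb) + (xb - u') + (u' - x') + (x' - z') := by abel
    rw [e3]
    rw [norm_sub_rev] at s4
    refine (norm_add_le _ _).trans ?_
    linarith [norm_add₃_le (a := p' - xb) (b := xb - u') (c := u' - x')]

end DSGDA

namespace DSGDA

variable {n d : ℕ} {f : E n → E d → ℝ} {X : Set (E n)} {Y : Set (E d)}
  {L K r₁ r₂ c α μ σ D : ℝ}

lemma le_of_half_sq_le {m G b a : ℝ} (hm : 0 < m) (hG : 0 ≤ G) (hb : 0 ≤ b)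
    (h : m / 2 * a ^ 2 ≤ G + b * a) : a ≤ 2 * √(G / m) + 2 * (b / m) := by
  by_contra! hlt
  set s := √(G / m) with hs
  have hs0 : 0 ≤ s := Real.sqrt_nonneg _
  have hk0 : 0 ≤ b / m := div_nonneg hb hm.le
  have e1 : G = m * s ^ 2 := by
    rw [hs, Real.sq_sqrt (div_nonneg hG hm.le)]
    field_simp
  have e2 : b = m * (b / m) := by field_simp
  set k := b / m
  have h2 : a ^ 2 / 2 ≤ s ^ 2 + k * a := by
    refine le_of_mul_le_mul_left ?_ hm
    rw [e1, e2] at h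
    linarith
  have ha : 0 < a := by linarith
  nlinarith [mul_lt_mul_of_pos_right hlt ha, mul_nonneg hs0 hk0]

lemma norm_extrapolation_le {n : ℕ} {x z : E n} {β ρ : ℝ} (hβ : 0 ≤ β) (hβ1 : β ≤ 1)
    (hx : ‖x‖ ≤ ρ) (hz : ‖z‖ ≤ ρ) : ‖z + β • (x - z)‖ ≤ ρ := by
  have h := (convex_closedBall (0 : E n) ρ).add_smul_sub_mem (mem_closedBall_zero_iff.2 hz)
    (mem_closedBall_zero_iff.2 hx) ⟨hβ, hβ1⟩
  exact mem_closedBall_zero_iff.1 h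

lemma norm_extrapolation_iterate_le {n : ℕ} {x z : ℕ → E n} {β ρ : ℝ} {T : ℕ} (hβ : 0 ≤ β)
    (hβ1 : β ≤ 1) (hx : ∀ t ≤ T, ‖x (t + 1)‖ ≤ ρ) (hz0 : ‖z 0‖ ≤ ρ)
    (hz : ∀ t ≤ T, z (t + 1) = z t + β • (x (t + 1) - z t)) : ∀ t ≤ T + 1, ‖z t‖ ≤ ρ := by
  intro t
  induction t with
  | zero => exact fun _ => hz0
  | succ t ih =>
    intro ht
    rw [hz t (by omega)]
    exact norm_extrapolation_le hβ hβ1 (hx t (by omega)) (ih (by omega))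

/-- A small increment at time `t`, together with a saddle point at `(z t, v t)` and the proximal point
at `z (t + 1)`. -/
structure SmallStep (f : E n → E d → ℝ) (X : Set (E n)) (Y : Set (E d))
    (L K r₁ r₂ c α μ σ D β δ : ℝ) (x x' z z' : E n) (y y' v v' : E d) (xb : E n) (yb : E d)
    (p : E n) : Prop where
  saddle : IsSaddle f X Y r₁ r₂ z v xb yb
  prox : IsProx f X Y r₁ z' p
  memX : x ∈ X
  memY : y ∈ Y
  increment : ‖x' - x‖ ^ 2 / (24 * c) + ‖y' - y‖ ^ 2 / (24 * α)
    + r₁ * ‖z' - z‖ ^ 2 / (16 * β) + r₂ * ‖v' - v‖ ^ 2 / (8 * μ) ≤ δ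
  dist_yb : α * (r₂ - K) * ‖y' - yb‖ ≤ (1 + α * D) * ‖y' - y‖ + α * K * σ * ‖x' - x‖
  dist_v : μ * ‖yb - v‖ ≤ ‖v' - v‖ + μ * ‖y' - yb‖
  dist_prox : ‖p - z'‖ ≤ ‖p - xb‖ + ‖y' - yb‖ + (σ * ‖x' - x‖ + ‖y' - y‖) + ‖x' - z‖

lemma IsRun.projX (hf : LipschitzGrad f X Y L K) {β : ℝ} {T : ℕ} {x : ℕ → E n} {y : ℕ → E d}
    {z : ℕ → E n} {v : ℕ → E d} (h : IsRun f X Y r₁ r₂ c α β μ T x y z v) {t : ℕ} (ht : t ≤ T) :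
    IsProj X (x t - c • (gradX f (x t) (y t) + r₁ • (x t - z t))) (x (t + 1)) := by
  have := h.stepX t ht
  rwa [hf.gradX_regF] at this

lemma IsRun.projY (hf : LipschitzGrad f X Y L K) {β : ℝ} {T : ℕ} {x : ℕ → E n} {y : ℕ → E d}
    {z : ℕ → E n} {v : ℕ → E d} (h : IsRun f X Y r₁ r₂ c α β μ T x y z v) {t : ℕ} (ht : t ≤ T) :
    IsProj Y (y t + α • (gradY f (x (t + 1)) (y t) - r₂ • (y t - v t))) (y (t + 1)) := by
  have := h.stepY t ht
  rwa [hf.gradY_regF] at this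

set_option maxHeartbeats 400000 in
/-- If the part of the duality gap which is not absorbed by the descent is summable, then one of the
first `T` increments is of order `1 / T`. -/
theorem exists_smallStep (hXne : X.Nonempty) (hXc : IsCompact X) (hX : Convex ℝ X)
    (hYne : Y.Nonempty) (hYc : IsCompact Y) (hY : Convex ℝ Y) (hf : LipschitzGrad f X Y L K)
    (h : StepBounds L K r₁ r₂ c α μ σ D) (z₀ : E n) (v₀ : E d) {M : ℝ} (hM : 0 ≤ M) :
    ∃ A : ℝ, 0 ≤ A ∧ ∀ (β : ℝ) (T : ℕ), 1 ≤ T → 0 < β → β ≤ 1 / 15 →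
      r₁ * β ≤ α * K ^ 2 / 1920 →
      ∀ (x : ℕ → E n) (y : ℕ → E d) (z : ℕ → E n) (v : ℕ → E d), z 0 = z₀ → v 0 = v₀ →
      IsRun f X Y r₁ r₂ c α β μ T x y z v →
      ∀ err : ℕ → ℝ, ∑ i ∈ Finset.range T, err (i + 1) ≤ M →
      (∀ t, 1 ≤ t → t ≤ T → ∀ xb yb, IsSaddle f X Y r₁ r₂ (z t) (v t) xb yb →
        4 * r₁ / (r₁ - L) * β * (maxY f Y xb - f xb yb) - r₂ * μ / 16 * ‖yb - v t‖ ^ 2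
          ≤ err t) →
      ∃ t, 1 ≤ t ∧ t ≤ T ∧ ∃ xb yb p, SmallStep f X Y L K r₁ r₂ c α μ σ D β (A / T)
        (x t) (x (t + 1)) (z t) (z (t + 1)) (y t) (y (t + 1)) (v t) (v (t + 1)) xb yb p := by
  have hL := h.L_pos
  have hr1 := h.r₁_ge
  have hr2 := h.r₂_ge
  have hK := h.K_pos
  have hμ := h.μ_pos
  have hr1p : 0 < r₁ := by linarith
  have hr2p : 0 < r₂ := by linarith
  obtain ⟨B, hB⟩ : ∃ B, ∀ x ∈ X, ∀ y ∈ Y, |f x y| ≤ B := by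
    obtain ⟨B, hB⟩ := (hXc.prod hYc).exists_bound_of_continuousOn hf.continuous.continuousOn
    exact ⟨B, fun x hx y hy => hB (x, y) ⟨hx, hy⟩⟩
  obtain ⟨ρ₁, hρ₁⟩ := hXc.exists_bound_of_continuousOn (f := fun x => x) continuousOn_id
  obtain ⟨ρ₂, hρ₂⟩ := hYc.exists_bound_of_continuousOn (f := fun y => y) continuousOn_id
  set ρ := max (max ρ₁ ‖z₀‖) (max ρ₂ ‖v₀‖) with hρ
  have hρX : ∀ x ∈ X, ‖x‖ ≤ ρ := fun x hx =>
    (hρ₁ x hx).trans ((le_max_left _ _).trans (le_max_left _ _))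
  have hρY : ∀ y ∈ Y, ‖y‖ ≤ ρ := fun y hy =>
    (hρ₂ y hy).trans ((le_max_left _ _).trans (le_max_right _ _))
  have hρz : ‖z₀‖ ≤ ρ := (le_max_right _ _).trans (le_max_left _ _)
  have hρv : ‖v₀‖ ≤ ρ := (le_max_right _ _).trans (le_max_right _ _)
  set A := |6 * B + 3 / 2 * r₁ * (2 * ρ) ^ 2 + r₂ * (2 * ρ) ^ 2| + M with hA
  have hA0 : 0 ≤ A := by positivity
  refine ⟨A, hA0, ?_⟩
  intro β T hT hβ hβ15 hβr x y z v hz0 hv0 hrun err herr hgap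
  have hTp : (0 : ℝ) < T := by exact_mod_cast hT
  have hxm : ∀ t ≤ T, x (t + 1) ∈ X := fun t ht => (hrun.stepX t ht).1
  have hym : ∀ t ≤ T, y (t + 1) ∈ Y := fun t ht => (hrun.stepY t ht).1
  have hzb := norm_extrapolation_iterate_le hβ.le (by linarith)
    (fun t ht => hρX _ (hxm t ht)) (by rw [hz0]; exact hρz) hrun.stepZ
  have hvb := norm_extrapolation_iterate_le hμ.le h.μ_lt_one.le
    (fun t ht => hρY _ (hym t ht)) (by rw [hv0]; exact hρv) hrun.stepV
  choose u hu using exists_isInner hf hXne hXc r₁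
  choose p hp using exists_isProx hf hXne hXc hYc r₁
  choose xb yb hsad using exists_isSaddle hf hXne hXc hX hYne hYc hY (by linarith : L < r₁) r₂
  set Φ : ℕ → ℝ := fun t =>
    potential f Y r₁ r₂ (x t) (y t) (z t) (v t) (u (y t) (z t)) (p (z t)) with hΦ
  set W : ℕ → ℝ := fun t => ‖x (t + 1) - x t‖ ^ 2 / (24 * c)
    + ‖y (t + 1) - y t‖ ^ 2 / (24 * α) + r₁ * ‖z (t + 1) - z t‖ ^ 2 / (16 * β)
    + r₂ * ‖v (t + 1) - v t‖ ^ 2 / (8 * μ) with hW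
  have hstep := fun i (hi : i < T) => step_estimates hf hX hY hYc h hβ hβ15 hβr
    (hxm i hi.le) (hym i hi.le) (hrun.projX hf hi) (hrun.projY hf hi)
    (hrun.stepZ (i + 1) hi) (hrun.stepV (i + 1) hi)
    (hu (y (i + 1)) (z (i + 1))) (hu (y (i + 1 + 1)) (z (i + 1)))
    (hu (y (i + 1 + 1)) (z (i + 1 + 1))) (hp (z (i + 1))) (hp (z (i + 1 + 1)))
    (hsad (z (i + 1)) (v (i + 1)))
  have hsum : ∑ i ∈ Finset.range T, W (i + 1) ≤ A := by
    have h1 : ∀ i ∈ Finset.range T, W (i + 1) ≤ err (i + 1) + (Φ (i + 1) - Φ (i + 1 + 1)) := by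
      intro i hi
      have hi' := Finset.mem_range.1 hi
      have a1 := (hstep i hi').1
      have a2 := hgap (i + 1) (by omega) (by omega) _ _ (hsad (z (i + 1)) (v (i + 1)))
      simp only [hW, hΦ]
      linarith
    have h2 := Finset.sum_le_sum h1
    have h3 := Finset.sum_range_sub' (fun i => Φ (i + 1)) T
    rw [Finset.sum_add_distrib (f := fun i => err (i + 1)), h3] at h2
    have h4 : Φ (0 + 1) ≤ 5 * B + 3 / 2 * r₁ * (2 * ρ) ^ 2 + r₂ * (2 * ρ) ^ 2 := by
      refine potential_le hYne hr1p.le hr2p.le hB (hxm 0 (by omega)) (hym 0 (by omega))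
        (hu _ _).1 (hp _) ?_ ?_
      · have a1 := norm_sub_le (x (0 + 1)) (z (0 + 1))
        have a2 := hρX _ (hxm 0 (by omega))
        have a3 := hzb (0 + 1) (by omega)
        linarith
      · have a1 := norm_sub_le (y (0 + 1)) (v (0 + 1))
        have a2 := hρY _ (hym 0 (by omega))
        have a3 := hvb (0 + 1) (by omega)
        linarith
    have h5 : -B ≤ Φ (T + 1) :=
      neg_le_potential hf hYc hr1p.le hr2p.le hB (hxm T le_rfl) (hym T le_rfl) (hu _ _) (hp _)
    have h6 := le_abs_self (6 * B + 3 / 2 * r₁ * (2 * ρ) ^ 2 + r₂ * (2 * ρ) ^ 2)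
    rw [hA]
    linarith
  obtain ⟨i, hi, hiW⟩ : ∃ i ∈ Finset.range T, W (i + 1) ≤ A / T := by
    refine Finset.exists_le_of_sum_le (Finset.nonempty_range_iff.2 (by omega)) ?_
    rw [Finset.sum_const, Finset.card_range, nsmul_eq_mul, mul_div_cancel₀ _ hTp.ne']
    exact hsum
  have hi' := Finset.mem_range.1 hi
  obtain ⟨-, e2, e3, e4⟩ := hstep i hi'
  exact ⟨i + 1, by omega, hi', _, _, _, hsad _ _, hp _, hxm i hi'.le, hym i hi'.le, hiW, e2, e3, e4⟩

/-- Bounds on the individual increments of a small step. -/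
lemma SmallStep.increments {β A T S δ : ℝ} {x x' z z' : E n} {y y' v v' : E d} {xb : E n} {yb : E d}
    {p : E n} (h : SmallStep f X Y L K r₁ r₂ c α μ σ D β δ x x' z z' y y' v v' xb yb p)
    (hδ : δ = A / T) (hT : 0 < T) (hβ : 0 < β) (hc : 0 < c) (hα : 0 < α) (hμ : 0 < μ)
    (hr₁ : 0 < r₁) (hr₂ : 0 < r₂) (hA : 0 ≤ A) (hz : z' = z + β • (x' - z))
    (hS : S = √(24 * c * A) + √(24 * α * A) + √(8 * μ / r₂ * A) + √(16 / r₁ * A)) :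
    ‖x' - x‖ ≤ S * (√T)⁻¹ ∧ ‖y' - y‖ ≤ S * (√T)⁻¹ ∧ ‖v' - v‖ ≤ S * (√T)⁻¹ ∧
      ‖x' - z‖ ≤ S * (√(β * T))⁻¹ := by
  have hW := h.increment
  rw [hδ] at hW
  have n1 : 0 ≤ ‖x' - x‖ ^ 2 / (24 * c) := by positivity
  have n2 : 0 ≤ ‖y' - y‖ ^ 2 / (24 * α) := by positivity
  have n3 : 0 ≤ r₁ * ‖z' - z‖ ^ 2 / (16 * β) := by positivity
  have n4 : 0 ≤ r₂ * ‖v' - v‖ ^ 2 / (8 * μ) := by positivity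
  have key : ∀ {a b τ : ℝ}, 0 ≤ b → 0 < τ → a ^ 2 ≤ b / τ → √b ≤ S → a ≤ S * (√τ)⁻¹ := by
    intro a b τ hb hτ hab hbS
    calc a ≤ √(b / τ) := Real.le_sqrt_of_sq_le hab
      _ = √b * (√τ)⁻¹ := by rw [Real.sqrt_div hb, div_eq_mul_inv]
      _ ≤ S * (√τ)⁻¹ := mul_le_mul_of_nonneg_right hbS (by positivity)
  have q1 : 0 ≤ √(24 * c * A) := Real.sqrt_nonneg _
  have q2 : 0 ≤ √(24 * α * A) := Real.sqrt_nonneg _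
  have q3 : 0 ≤ √(8 * μ / r₂ * A) := Real.sqrt_nonneg _
  have q4 : 0 ≤ √(16 / r₁ * A) := Real.sqrt_nonneg _
  refine ⟨?_, ?_, ?_, ?_⟩
  · refine key (b := 24 * c * A) (by positivity) hT ?_ (by linarith)
    have : ‖x' - x‖ ^ 2 / (24 * c) ≤ A / T := by linarith
    rw [div_le_iff₀ (by positivity)] at this
    linarith [mul_div_assoc (24 * c) A T]
  · refine key (b := 24 * α * A) (by positivity) hT ?_ (by linarith)
    have : ‖y' - y‖ ^ 2 / (24 * α) ≤ A / T := by linarith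
    rw [div_le_iff₀ (by positivity)] at this
    linarith [mul_div_assoc (24 * α) A T]
  · refine key (b := 8 * μ / r₂ * A) (by positivity) hT ?_ (by linarith)
    have : r₂ * ‖v' - v‖ ^ 2 / (8 * μ) ≤ A / T := by linarith
    calc ‖v' - v‖ ^ 2 = 8 * μ / r₂ * (r₂ * ‖v' - v‖ ^ 2 / (8 * μ)) := by field_simp
      _ ≤ 8 * μ / r₂ * (A / T) := mul_le_mul_of_nonneg_left this (by positivity)
      _ = _ := by ring
  · refine key (b := 16 / r₁ * A) (by positivity) (mul_pos hβ hT) ?_ (by linarith)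
    have : r₁ * ‖z' - z‖ ^ 2 / (16 * β) ≤ A / T := by linarith
    rw [hz, add_sub_cancel_left, norm_smul, Real.norm_of_nonneg hβ.le] at this
    calc ‖x' - z‖ ^ 2 = 16 / (r₁ * β) * (r₁ * (β * ‖x' - z‖) ^ 2 / (16 * β)) := by field_simp
      _ ≤ 16 / (r₁ * β) * (A / T) := mul_le_mul_of_nonneg_left this (by positivity)
      _ = _ := by field_simp

end DSGDA

namespace DSGDA

variable {n d : ℕ} {f : E n → E d → ℝ} {X : Set (E n)} {Y : Set (E d)}
  {L K r₁ r₂ c α μ σ D : ℝ}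

set_option maxHeartbeats 1000000 in
/-- If the part of the duality gap which is not absorbed by the descent is summable, then one of the
first `T` steps yields a point with small stationarity measures. -/
theorem exists_good_step (hXne : X.Nonempty) (hXc : IsCompact X) (hX : Convex ℝ X)
    (hYne : Y.Nonempty) (hYc : IsCompact Y) (hY : Convex ℝ Y) (hf : LipschitzGrad f X Y L K)
    (h : StepBounds L K r₁ r₂ c α μ σ D) (z₀ : E n) (v₀ : E d) {M : ℝ} (hM : 0 ≤ M) :
    ∃ C : ℝ, 0 < C ∧ ∀ (β : ℝ) (T : ℕ), 1 ≤ T → 0 < β → β ≤ 1 / 15 →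
      r₁ * β ≤ α * K ^ 2 / 1920 →
      ∀ (x : ℕ → E n) (y : ℕ → E d) (z : ℕ → E n) (v : ℕ → E d), z 0 = z₀ → v 0 = v₀ →
      IsRun f X Y r₁ r₂ c α β μ T x y z v →
      ∀ err : ℕ → ℝ, ∑ i ∈ Finset.range T, err (i + 1) ≤ M →
      (∀ t, 1 ≤ t → t ≤ T → ∀ xb yb, IsSaddle f X Y r₁ r₂ (z t) (v t) xb yb →
        4 * r₁ / (r₁ - L) * β * (maxY f Y xb - f xb yb) - r₂ * μ / 16 * ‖yb - v t‖ ^ 2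
          ≤ err t) →
      ∃ t, 1 ≤ t ∧ t ≤ T ∧ ∃ xb yb, IsSaddle f X Y r₁ r₂ (z t) (v t) xb yb ∧
        ‖yb - v t‖ ≤ C * (√T)⁻¹ ∧
        IsGS f X Y (C * (√(β * T))⁻¹) (x (t + 1)) (y (t + 1)) ∧
        IsOS f X Y r₁ (C * ((√(β * T))⁻¹ + √(maxY f Y xb - f xb yb))) (z (t + 1)) := by
  have hL := h.L_pos
  have hr1 := h.r₁_ge
  have hr2 := h.r₂_ge
  have hK := h.K_pos
  have hα := h.α_pos
  have hc := h.c_pos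
  have hμ := h.μ_pos
  have hσ := h.σ_pos
  have hm : 0 < r₁ - L := by linarith
  have hr1p : 0 < r₁ := by linarith
  have hr2p : 0 < r₂ := by linarith
  have hr2K : 0 < r₂ - K := by linarith
  have hD : 0 < D := by linarith [h.le_D']
  obtain ⟨A, hA0, hmain⟩ := exists_smallStep hXne hXc hX hYne hYc hY hf h z₀ v₀ hM
  set S := √(24 * c * A) + √(24 * α * A) + √(8 * μ / r₂ * A) + √(16 / r₁ * A) with hS
  have hS0 : 0 ≤ S := by positivity
  set Q := ((1 + α * D) * S + α * K * σ * S) / (α * (r₂ - K)) with hQ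
  have hQ0 : 0 ≤ Q := by positivity
  set C₁ := (S + μ * Q) / μ with hC₁
  set C₂ := (L + 1 / c + r₁) * S + L * S + r₁ * S with hC₂
  set C₃ := (K + 1 / α + r₂) * S + r₂ * (S / μ) with hC₃
  set C₄ := 2 * (r₁ / (r₁ - L)) * S + Q + (σ * S + S) + S with hC₄
  set C₅ := 2 * √(1 / (r₁ - L)) with hC₅
  have hC₁0 : 0 ≤ C₁ := by positivity
  have hC₂0 : 0 ≤ C₂ := by positivity
  have hC₃0 : 0 ≤ C₃ := by positivity
  have hC₄0 : 0 ≤ C₄ := by positivity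
  have hC₅0 : 0 ≤ C₅ := by positivity
  refine ⟨C₁ + C₂ + C₃ + C₄ + C₅ + 1, by positivity, ?_⟩
  set C := C₁ + C₂ + C₃ + C₄ + C₅ + 1 with hC
  intro β T hT hβ hβ15 hβr x y z v hz0 hv0 hrun err herr hgap
  have hTp : (0 : ℝ) < T := by exact_mod_cast hT
  obtain ⟨t, ht1, htT, xb', yb', p', hstep⟩ :=
    hmain β T hT hβ hβ15 hβr x y z v hz0 hv0 hrun err herr hgap
  obtain ⟨bX, bY, bV, bZ⟩ := hstep.increments rfl hTp hβ hc hα hμ hr1p hr2p hA0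
    (hrun.stepZ t htT) hS
  obtain ⟨hsad', hpp, hxt, hyt, -, e2, e3, e4⟩ := hstep
  have hx't := (hrun.stepX t htT).1
  have hy't := (hrun.stepY t htT).1
  refine ⟨t, ht1, htT, xb', yb', hsad', ?_⟩
  clear_value S
  set s := (√(T : ℝ))⁻¹ with hs
  set η := (√(β * T))⁻¹ with hη
  have hs0 : 0 ≤ s := by positivity
  have hη0 : 0 ≤ η := by positivity
  have hsη : s ≤ η := by
    refine inv_anti₀ (Real.sqrt_pos.2 (mul_pos hβ hTp)) (Real.sqrt_le_sqrt ?_)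
    linarith [mul_le_mul_of_nonneg_right hβ15 hTp.le]
  have eZ : ‖z (t + 1) - z t‖ = β * ‖x (t + 1) - z t‖ := by
    rw [hrun.stepZ t htT, add_sub_cancel_left, norm_smul, Real.norm_of_nonneg hβ.le]
  have eV : ‖v (t + 1) - v t‖ = μ * ‖y (t + 1) - v t‖ := by
    rw [hrun.stepV t htT, add_sub_cancel_left, norm_smul, Real.norm_of_nonneg hμ.le]
  have bZ' : ‖z (t + 1) - z t‖ ≤ S * η := by
    rw [eZ]
    linarith [mul_le_mul_of_nonneg_right hβ15 (norm_nonneg (x (t + 1) - z t)), norm_nonneg (x (t + 1) - z t)]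
  have bYV : ‖y (t + 1) - v t‖ ≤ S / μ * s := by
    rw [eV] at bV
    rw [div_mul_eq_mul_div, le_div_iff₀ hμ]
    linarith
  have bQ : ‖y (t + 1) - yb'‖ ≤ Q * s := by
    rw [hQ, div_mul_eq_mul_div, le_div_iff₀ (by positivity)]
    have a1 := mul_le_mul_of_nonneg_left bY (by positivity : 0 ≤ 1 + α * D)
    have a2 := mul_le_mul_of_nonneg_left bX (by positivity : 0 ≤ α * K * σ)
    linarith
  clear_value s η Q C
  have hSη : S * s ≤ S * η := mul_le_mul_of_nonneg_left hsη hS0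
  have hQη : Q * s ≤ Q * η := mul_le_mul_of_nonneg_left hsη hQ0
  have hCη : ∀ {a : ℝ}, a ≤ C → a * η ≤ C * η := fun ha => mul_le_mul_of_nonneg_right ha hη0
  refine ⟨?_, ⟨hx't, hy't, ?_, ?_⟩, p', hpp, ?_⟩
  · have a1 : ‖yb' - v t‖ ≤ C₁ * s := by
      rw [hC₁, div_mul_eq_mul_div, le_div_iff₀ hμ]
      linarith [mul_le_mul_of_nonneg_left bQ hμ.le]
    exact a1.trans (mul_le_mul_of_nonneg_right (by linarith) hs0)
  · refine le_trans ?_ (hCη (by linarith : C₂ ≤ C))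
    have a1 := statDist_x_le hf hX hr1p.le hc hxt hyt hy't (hrun.projX hf htT)
    have a2 := mul_le_mul_of_nonneg_left (bX.trans hSη) (by positivity : 0 ≤ L + 1 / c + r₁)
    have a3 := mul_le_mul_of_nonneg_left (bY.trans hSη) hL.le
    have a4 := mul_le_mul_of_nonneg_left bZ hr1p.le
    rw [hC₂]
    linarith
  · refine le_trans ?_ (hCη (by linarith : C₃ ≤ C))
    have a1 := statDist_y_le hf hY hr2p.le hα hx't hyt (hrun.projY hf htT)
    have a2 := mul_le_mul_of_nonneg_left (bY.trans hSη) (by positivity : 0 ≤ K + 1 / α + r₂)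
    have a3 := mul_le_mul_of_nonneg_left bYV hr2p.le
    have a4 := mul_le_mul_of_nonneg_left hsη (by positivity : 0 ≤ r₂ * (S / μ))
    rw [hC₃]
    linarith
  · set G := maxY f Y xb' - f xb' yb' with hG
    have hG0 : 0 ≤ G := sub_nonneg.2 (hf.le_maxY hYc xb' hsad'.mem)
    have a1 := hsad'.dist_isProx_le hf hX hYc hr1p.le hpp
    have a2 := le_of_half_sq_le hm hG0 (by positivity) a1
    have a3 : √(G / (r₁ - L)) = √(1 / (r₁ - L)) * √G := by
      rw [← Real.sqrt_mul (by positivity)]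
      congr 1
      ring
    have a4 : r₁ * ‖z (t + 1) - z t‖ / (r₁ - L) ≤ r₁ / (r₁ - L) * (S * η) := by
      rw [mul_div_right_comm]
      exact mul_le_mul_of_nonneg_left bZ' (by positivity)
    have a5 : C₅ * √G ≤ C * √G :=
      mul_le_mul_of_nonneg_right (by linarith) (Real.sqrt_nonneg _)
    have a6 := hCη (by linarith : C₄ ≤ C)
    have a7 := mul_le_mul_of_nonneg_left (bX.trans hSη) hσ.le
    rw [a3] at a2
    rw [hC₅] at a5
    rw [hC₄] at a6
    linarith

end DSGDA

namespace DSGDA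

variable {n d : ℕ} {f : E n → E d → ℝ} {X : Set (E n)} {Y : Set (E d)}
  {L K r₁ r₂ c α μ σ D : ℝ}

lemma IsSaddle.gap_nonneg (hf : LipschitzGrad f X Y L K) (hYc : IsCompact Y) {z : E n} {v : E d}
    {x : E n} {y : E d} (h : IsSaddle f X Y r₁ r₂ z v x y) : 0 ≤ maxY f Y x - f x y :=
  sub_nonneg.2 (hf.le_maxY hYc x h.mem)

lemma IsSaddle.gap_le_of_dualKL (hf : LipschitzGrad f X Y L K) (hYc : IsCompact Y) (hr₂ : 0 ≤ r₂)
    {τ θ : ℝ} (hτ : 0 < τ) (hθ : 0 < θ) (hKL : DualKL f X Y τ θ) {z : E n} {v : E d} {x : E n}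
    {y : E d} (h : IsSaddle f X Y r₁ r₂ z v x y) :
    maxY f Y x - f x y ≤ (r₂ / τ) ^ (1 / θ) * ‖y - v‖ ^ (1 / θ) := by
  have hG := h.gap_nonneg hf hYc
  have h1 := hKL x h.inner.1 y h.mem
  have h2 : statDist Y (-gradY f x y) y ≤ r₂ * ‖y - v‖ := by
    refine (statDist_le h.mem h.vi).trans ?_
    have e : -gradY f x y + (gradY f x y - r₂ • (y - v)) = -(r₂ • (y - v)) := by abel
    rw [e, norm_neg, norm_smul, Real.norm_of_nonneg hr₂]
  have h3 : (maxY f Y x - f x y) ^ θ ≤ r₂ / τ * ‖y - v‖ := by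
    refine h1.trans ?_
    have := mul_le_mul_of_nonneg_left h2 (one_div_pos.2 hτ).le
    refine this.trans (le_of_eq ?_)
    ring
  rw [← Real.mul_rpow (div_nonneg hr₂ hτ.le) (norm_nonneg _)]
  calc maxY f Y x - f x y = ((maxY f Y x - f x y) ^ θ) ^ (1 / θ) := by
        rw [← Real.rpow_mul hG, mul_one_div_cancel hθ.ne', Real.rpow_one]
    _ ≤ _ := Real.rpow_le_rpow (Real.rpow_nonneg hG _) h3 (by positivity)

lemma IsSaddle.gap_le_of_concave (hf : LipschitzGrad f X Y L K) (hYc : IsCompact Y)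
    (hr₂ : 0 ≤ r₂) (hcc : DualConcave f X Y) {z : E n} {v : E d} {x : E n}
    {y : E d} (h : IsSaddle f X Y r₁ r₂ z v x y) :
    maxY f Y x - f x y ≤ r₂ * Metric.diam Y * ‖y - v‖ := by
  have hY := (hcc x h.inner.1).1
  rw [sub_le_iff_le_add]
  refine maxY_le ⟨y, h.mem⟩ fun y' hy' => ?_
  have h1 : 0 ≤ ⟪gradY f x y, y' - y⟫_ℝ + f x y - f x y' := by
    refine nonneg_of_forall_quadratic_nonneg (b := K / 2 * ‖y' - y‖ ^ 2) fun s hs hs1 => ?_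
    have hm : y + s • (y' - y) ∈ Y := hY.add_smul_sub_mem h.mem hy' ⟨hs.le, hs1⟩
    have a1 := hf.le_quadratic_y hY h.inner.1 h.mem hm
    have a2 := (hcc x h.inner.1).2 h.mem hy' (sub_nonneg.2 hs1) hs.le (by ring)
    have e : (1 - s) • y + s • y' = y + s • (y' - y) := by module
    simp only [e, smul_eq_mul] at a2
    rw [add_sub_cancel_left, norm_smul, mul_pow, Real.norm_eq_abs, sq_abs,
      real_inner_smul_right] at a1
    linarith
  have h2 := h.vi y' hy'
  rw [inner_sub_left, real_inner_smul_left] at h2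
  have h3 : ⟪y - v, y' - y⟫_ℝ ≤ ‖y - v‖ * Metric.diam Y := by
    refine (real_inner_le_norm _ _).trans (mul_le_mul_of_nonneg_left ?_ (norm_nonneg _))
    rw [← dist_eq_norm]
    exact Metric.dist_le_diam_of_mem hYc.isBounded hy' h.mem
  linarith [mul_le_mul_of_nonneg_left h3 hr₂]

lemma IsSaddle.gap_eq_zero_of_diam (hf : LipschitzGrad f X Y L K) (hYc : IsCompact Y)
    (hd : Metric.diam Y = 0) {z : E n} {v : E d} {x : E n} {y : E d}
    (h : IsSaddle f X Y r₁ r₂ z v x y) : maxY f Y x - f x y = 0 := by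
  refine le_antisymm ?_ (h.gap_nonneg hf hYc)
  rw [sub_nonpos]
  refine maxY_le ⟨y, h.mem⟩ fun y' hy' => ?_
  have h1 := Metric.dist_le_diam_of_mem hYc.isBounded hy' h.mem
  rw [hd] at h1
  rw [dist_le_zero.1 h1]

lemma IsGS.mono {ε ε' : ℝ} {x : E n} {y : E d} (h : IsGS f X Y ε x y) (hε : ε ≤ ε') :
    IsGS f X Y ε' x y :=
  ⟨h.1, h.2.1, h.2.2.1.trans hε, h.2.2.2.trans hε⟩

lemma IsOS.mono {r ε ε' : ℝ} {z : E n} (h : IsOS f X Y r ε z) (hε : ε ≤ ε') :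
    IsOS f X Y r ε' z :=
  h.imp fun _ hw => ⟨hw.1, hw.2.trans hε⟩

/-- Young's inequality in the form that absorbs a subquadratic power into a square. -/
lemma young_absorb {θ a η : ℝ} (hθ : 1 / 2 < θ) (ha : 0 ≤ a) (hη : 0 < η) :
    ∃ C : ℝ, 0 ≤ C ∧ ∀ β w : ℝ, 0 ≤ β → 0 ≤ w →
      a * β * w ^ (1 / θ) ≤ η * w ^ 2 + C * β ^ (2 * θ / (2 * θ - 1)) := by
  have hp : 1 < 2 * θ := by linarith
  have hpq := Real.HolderConjugate.conjExponent hp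
  set q := Real.conjExponent (2 * θ) with hq
  have hq' : q = 2 * θ / (2 * θ - 1) := rfl
  have hθ0 : 0 < θ := by linarith
  refine ⟨(a * η ^ (-(1 / (2 * θ)))) ^ q, by positivity, fun β w hβ hw => ?_⟩
  have h1 := Real.young_inequality_of_nonneg (a := (η * w ^ 2) ^ (1 / (2 * θ)))
    (b := a * η ^ (-(1 / (2 * θ))) * β) (by positivity) (by positivity) hpq
  have e1 : ((η * w ^ 2) ^ (1 / (2 * θ))) ^ (2 * θ) = η * w ^ 2 := by
    rw [← Real.rpow_mul (by positivity), one_div_mul_cancel (by positivity), Real.rpow_one]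
  have e2 : (η * w ^ 2) ^ (1 / (2 * θ)) = η ^ (1 / (2 * θ)) * w ^ (1 / θ) := by
    rw [Real.mul_rpow hη.le (by positivity), ← Real.rpow_natCast w 2, ← Real.rpow_mul hw]
    congr 2
    push_cast
    field_simp
  have e3 : η ^ (1 / (2 * θ)) * η ^ (-(1 / (2 * θ))) = 1 := by
    rw [← Real.rpow_add hη, add_neg_cancel, Real.rpow_zero]
  have e4 : (η * w ^ 2) ^ (1 / (2 * θ)) * (a * η ^ (-(1 / (2 * θ))) * β)
      = a * β * w ^ (1 / θ) := by
    rw [e2]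
    linear_combination (a * β * w ^ (1 / θ)) * e3
  rw [e4, e1, Real.mul_rpow (by positivity) hβ] at h1
  rw [← hq']
  refine h1.trans (add_le_add (div_le_self (by positivity) hp.le)
    (div_le_self (by positivity) hpq.symm.lt.le))

lemma inv_sqrt_eq_rpow {a : ℝ} (ha : 0 ≤ a) : (√a)⁻¹ = a ^ (-(1 / 2) : ℝ) := by
  rw [Real.sqrt_eq_rpow, Real.rpow_neg ha]

/-- Rate when the duality gap at saddle points is controlled by a subquadratic power. -/
theorem findsStationary_of_gap_le_rpow (hXne : X.Nonempty) (hXc : IsCompact X)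
    (hX : Convex ℝ X) (hYne : Y.Nonempty) (hYc : IsCompact Y) (hY : Convex ℝ Y)
    (hf : LipschitzGrad f X Y L K) (h : StepBounds L K r₁ r₂ c α μ σ D) (z₀ : E n) (v₀ : E d)
    {θ Ω : ℝ} (hθ : 1 / 2 < θ) (hΩ : 0 ≤ Ω)
    (hgap : ∀ z v x y, IsSaddle f X Y r₁ r₂ z v x y →
      maxY f Y x - f x y ≤ Ω * ‖y - v‖ ^ (1 / θ)) {κ₂ : ℝ} (hκ₂ : 0 < κ₂) :
    ∃ C : ℝ, 0 < C ∧ ∀ (κ₁ β : ℝ) (T : ℕ), 0 < κ₁ → 1 ≤ T → 0 < β → β ≤ 1 / 15 →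
      r₁ * β ≤ α * K ^ 2 / 1920 →
      κ₁ * (T : ℝ) ^ (-((2 * θ - 1) / (2 * θ))) ≤ β →
      β ≤ κ₂ * (T : ℝ) ^ (-((2 * θ - 1) / (2 * θ))) →
      ∀ (x : ℕ → E n) (y : ℕ → E d) (z : ℕ → E n) (v : ℕ → E d), z 0 = z₀ → v 0 = v₀ →
      IsRun f X Y r₁ r₂ c α β μ T x y z v →
      FindsStationary f X Y r₁ T x y z
        (C * κ₁ ^ (-(1 / 2) : ℝ) * (T : ℝ) ^ (-(1 / (4 * θ)))) := by
  have hL := h.L_pos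
  have hr1 := h.r₁_ge
  have hr2 := h.r₂_ge
  have hK := h.K_pos
  have hμ := h.μ_pos
  have hm : 0 < r₁ - L := by linarith
  have hr1p : 0 < r₁ := by linarith
  have hr2p : 0 < r₂ := by linarith
  have hθ0 : 0 < θ := by linarith
  have hp : 0 < 2 * θ - 1 := by linarith
  obtain ⟨C₀, hC₀, hyoung⟩ := young_absorb (a := 4 * r₁ / (r₁ - L) * Ω) (η := r₂ * μ / 16) hθ
    (by positivity) (by positivity)
  set q := 2 * θ / (2 * θ - 1) with hq
  have hM : 0 ≤ C₀ * κ₂ ^ q := by positivity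
  obtain ⟨C, hC, hmain⟩ := exists_good_step hXne hXc hX hYne hYc hY hf h z₀ v₀ hM
  refine ⟨C * (1 + √Ω * C ^ (1 / (2 * θ)) * κ₂ ^ (1 / 2 : ℝ)), by positivity, ?_⟩
  intro κ₁ β T hκ₁ hT hβ hβ15 hβr hβ1 hβ2 x y z v hz0 hv0 hrun
  have hTp : (0 : ℝ) < T := by exact_mod_cast hT
  obtain ⟨t, ht1, htT, xb, yb, hs, hw, hGS, hOS⟩ := hmain β T hT hβ hβ15 hβr x y z v hz0 hv0 hrun
    (fun _ => C₀ * κ₂ ^ q / T) (by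
      rw [Finset.sum_const, Finset.card_range, nsmul_eq_mul, mul_div_cancel₀ _ hTp.ne'])
    (by
      intro t _ _ xb yb hs
      have a1 := hyoung β ‖yb - v t‖ hβ.le (norm_nonneg _)
      have a2 := mul_le_mul_of_nonneg_left (hgap _ _ _ _ hs)
        (by positivity : 0 ≤ 4 * r₁ / (r₁ - L) * β)
      have a3 : β ^ q ≤ κ₂ ^ q / T := by
        calc β ^ q ≤ (κ₂ * (T : ℝ) ^ (-((2 * θ - 1) / (2 * θ)))) ^ q :=
              Real.rpow_le_rpow hβ.le hβ2 (by positivity)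
          _ = κ₂ ^ q / T := by
              rw [Real.mul_rpow hκ₂.le (by positivity), ← Real.rpow_mul hTp.le]
              have : -((2 * θ - 1) / (2 * θ)) * q = -1 := by
                rw [hq]
                field_simp
              rw [this, Real.rpow_neg_one, div_eq_mul_inv]
      have a4 := mul_le_mul_of_nonneg_left a3 hC₀
      rw [← mul_div_assoc] at a4
      linarith)
  have b1 : (√(β * T))⁻¹ ≤ κ₁ ^ (-(1 / 2) : ℝ) * (T : ℝ) ^ (-(1 / (4 * θ))) := by
    have a1 : κ₁ * (T : ℝ) ^ (1 / (2 * θ)) ≤ β * T := by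
      have := mul_le_mul_of_nonneg_right hβ1 hTp.le
      refine le_trans (le_of_eq ?_) this
      rw [mul_assoc]
      congr 1
      nth_rw 3 [← Real.rpow_one (T : ℝ)]
      rw [← Real.rpow_add hTp]
      congr 1
      field_simp
      ring
    calc (√(β * T))⁻¹ ≤ (√(κ₁ * (T : ℝ) ^ (1 / (2 * θ))))⁻¹ :=
          inv_anti₀ (Real.sqrt_pos.2 (by positivity)) (Real.sqrt_le_sqrt a1)
      _ = _ := by
          rw [inv_sqrt_eq_rpow (by positivity), Real.mul_rpow hκ₁.le (by positivity),
            ← Real.rpow_mul hTp.le]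
          congr 2
          field_simp
          norm_num
  have b2 : 1 ≤ κ₂ ^ (1 / 2 : ℝ) * κ₁ ^ (-(1 / 2) : ℝ) := by
    have hκ : κ₁ ≤ κ₂ :=
      le_of_mul_le_mul_right (hβ1.trans hβ2) (Real.rpow_pos_of_pos hTp _)
    calc (1 : ℝ) = κ₁ ^ (1 / 2 : ℝ) * κ₁ ^ (-(1 / 2) : ℝ) := by
          rw [← Real.rpow_add hκ₁, add_neg_cancel, Real.rpow_zero]
      _ ≤ _ := mul_le_mul_of_nonneg_right
          (Real.rpow_le_rpow hκ₁.le hκ (by norm_num)) (by positivity)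
  have b3 : √(maxY f Y xb - f xb yb) ≤ √Ω * C ^ (1 / (2 * θ)) * (T : ℝ) ^ (-(1 / (4 * θ))) := by
    have a1 := hgap _ _ _ _ hs
    calc √(maxY f Y xb - f xb yb) ≤ √(Ω * ‖yb - v t‖ ^ (1 / θ)) := Real.sqrt_le_sqrt a1
      _ = √Ω * ‖yb - v t‖ ^ (1 / (2 * θ)) := by
          rw [Real.sqrt_mul hΩ, Real.sqrt_eq_rpow (‖yb - v t‖ ^ (1 / θ)),
            ← Real.rpow_mul (norm_nonneg _)]
          congr 2
          field_simp
      _ ≤ √Ω * (C * (√T)⁻¹) ^ (1 / (2 * θ)) :=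
          mul_le_mul_of_nonneg_left (Real.rpow_le_rpow (norm_nonneg _) hw (by positivity))
            (Real.sqrt_nonneg _)
      _ = _ := by
          rw [inv_sqrt_eq_rpow hTp.le, Real.mul_rpow hC.le (by positivity),
            ← Real.rpow_mul hTp.le, mul_assoc]
          congr 3
          field_simp
          norm_num
  set ε₀ := κ₁ ^ (-(1 / 2) : ℝ) * (T : ℝ) ^ (-(1 / (4 * θ))) with hε₀
  have hε₀0 : 0 ≤ ε₀ := by positivity
  have b4 : (T : ℝ) ^ (-(1 / (4 * θ))) ≤ κ₂ ^ (1 / 2 : ℝ) * ε₀ := by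
    have := mul_le_mul_of_nonneg_right b2 (by positivity : 0 ≤ (T : ℝ) ^ (-(1 / (4 * θ))))
    rw [hε₀]
    linarith
  have b5 := mul_le_mul_of_nonneg_left b4 (by positivity : 0 ≤ √Ω * C ^ (1 / (2 * θ)))
  have b6 : 0 ≤ √Ω * C ^ (1 / (2 * θ)) * κ₂ ^ (1 / 2 : ℝ) := by positivity
  refine ⟨t, ht1, htT, hGS.mono ?_, hOS.mono ?_⟩
  · rw [mul_assoc _ (κ₁ ^ (-(1 / 2) : ℝ)), ← hε₀, mul_assoc]
    refine mul_le_mul_of_nonneg_left ?_ hC.le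
    linarith [mul_nonneg b6 hε₀0]
  · rw [mul_assoc _ (κ₁ ^ (-(1 / 2) : ℝ)), ← hε₀, mul_assoc C]
    refine mul_le_mul_of_nonneg_left ?_ hC.le
    linarith

end DSGDA

namespace DSGDA

variable {n d : ℕ} {f : E n → E d → ℝ} {X : Set (E n)} {Y : Set (E d)}
  {L K r₁ r₂ c α μ σ D : ℝ}

lemma norm_extrapolation_sub_le {T : ℕ} {y v : ℕ → E d} {a : E d} {ρ : ℝ}
    (hμ : 0 < μ) (hμ1 : μ < 1) (hy : ∀ t ≤ T, ‖y (t + 1) - a‖ ≤ ρ) (hρ : 0 ≤ ρ)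
    (hv : ∀ t ≤ T, v (t + 1) = v t + μ • (y (t + 1) - v t)) :
    ∀ t ≤ T + 1, ‖v t - a‖ ≤ (1 - μ) ^ t * ‖v 0 - a‖ + ρ := by
  intro t
  induction t with
  | zero => intro _; simpa using hρ
  | succ t ih =>
    intro ht
    have e : v (t + 1) - a = (1 - μ) • (v t - a) + μ • (y (t + 1) - a) := by
      rw [hv t (by omega)]
      module
    rw [e]
    refine (norm_add_le _ _).trans ?_
    rw [norm_smul, norm_smul, Real.norm_of_nonneg hμ.le, Real.norm_of_nonneg (by linarith), pow_succ]
    have h1 := mul_le_mul_of_nonneg_left (ih (by omega)) (by linarith : 0 ≤ 1 - μ)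
    have h2 := mul_le_mul_of_nonneg_left (hy t (by omega)) hμ.le
    linarith

/-- After finitely many steps the extrapolated dual iterate is close to `Y`, uniformly over all
runs. -/
lemma exists_forall_mul_norm_le (hYc : IsCompact Y) (hμ : 0 < μ) (hμ1 : μ < 1) (v₀ : E d)
    (hd : 0 < Metric.diam Y) :
    ∃ N : ℕ, ∀ (T : ℕ) (y v : ℕ → E d), v 0 = v₀ → (∀ t ≤ T, y (t + 1) ∈ Y) →
      (∀ t ≤ T, v (t + 1) = v t + μ • (y (t + 1) - v t)) →
      ∀ t, N ≤ t → t ≤ T + 1 → ∀ yb ∈ Y, μ * ‖yb - v t‖ ≤ 2 * Metric.diam Y := by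
  rcases Y.eq_empty_or_nonempty with rfl | ⟨a, ha⟩
  · simp at hd
  have hlim : Filter.Tendsto (fun N : ℕ => (1 - μ) ^ N * ‖v₀ - a‖) Filter.atTop (nhds 0) := by
    have := (tendsto_pow_atTop_nhds_zero_of_lt_one (by linarith : 0 ≤ 1 - μ)
      (by linarith)).mul_const ‖v₀ - a‖
    rwa [zero_mul] at this
  have hpos : 0 < 2 * Metric.diam Y * (1 - μ) := by
    have : 0 < 1 - μ := by linarith
    positivity
  obtain ⟨N, hN⟩ := Filter.eventually_atTop.1 (hlim.eventually_le_const hpos)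
  refine ⟨N, fun T y v hv0 hy hv t htN htT yb hyb => ?_⟩
  have hdist : ∀ y ∈ Y, ‖y - a‖ ≤ Metric.diam Y := fun y hy => by
    rw [← dist_eq_norm]
    exact Metric.dist_le_diam_of_mem hYc.isBounded hy ha
  have h1 := norm_extrapolation_sub_le hμ hμ1 (fun t ht => hdist _ (hy t ht)) hd.le hv t htT
  have h2 := hN t htN
  rw [hv0] at h1
  have h3 : ‖yb - v t‖ ≤ ‖yb - a‖ + ‖v t - a‖ := by
    have := norm_sub_le (yb - a) (v t - a)
    rwa [sub_sub_sub_cancel_right] at this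
  have h4 := hdist yb hyb
  have h5 : ‖yb - v t‖ ≤ 2 * Metric.diam Y + 2 * Metric.diam Y * (1 - μ) := by linarith
  have h6 := mul_le_mul_of_nonneg_left h5 hμ.le
  nlinarith [mul_nonneg hd.le (sq_nonneg (1 - μ))]

lemma rpow_le_mul_sq {ρ w W : ℝ} (hρ : 2 ≤ ρ) (hw : 0 ≤ w) (hwW : w ≤ W) :
    w ^ ρ ≤ W ^ (ρ - 2) * w ^ 2 := by
  have e : w ^ ρ = w ^ (ρ - 2) * w ^ (2 : ℝ) := by
    rw [← Real.rpow_add_of_nonneg hw (by linarith) (by norm_num)]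
    congr 1
    ring
  rw [e, Real.rpow_two]
  exact mul_le_mul_of_nonneg_right (Real.rpow_le_rpow hw hwW (by linarith)) (sq_nonneg _)

/-- The descent absorbs the duality gap once the dual iterate is close to `Y`. -/
lemma gap_absorbed {β τ θ g w lam : ℝ} (h : StepBounds L (lam * L) r₁ r₂ c α μ σ D)
    (hβ : 0 < β) (hτ : 0 < τ) (hθ0 : 0 < θ) (hθ : θ ≤ 1 / 2) (hw : 0 ≤ w)
    (hg : g ≤ (r₂ / τ) ^ (1 / θ) * w ^ (1 / θ)) {δ : ℝ} (hδ : μ * w ≤ 2 * δ)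
    (hcond : β * (32 * r₁ * μ * omega0 L lam r₁ r₂ μ τ θ * (2 * δ) ^ (1 / θ - 2)) ≤ r₂) :
    4 * r₁ / (r₁ - L) * β * g ≤ r₂ * μ / 16 * w ^ 2 := by
  have hL := h.L_pos
  have hr1 := h.r₁_ge
  have hr2 := h.r₂_ge
  have hK := h.K_pos
  have hμ := h.μ_pos
  have hm : 0 < r₁ - L := by linarith
  have hr1p : 0 < r₁ := by linarith
  have hr2p : 0 < r₂ := by linarith
  have hr2K : 0 < r₂ - lam * L := by linarith
  have hρ : 2 ≤ 1 / θ := by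
    rw [le_div_iff₀ hθ0]
    linarith
  set ρ := 1 / θ with hρd
  have a1 : r₂ / μ ≤ r₂ * (1 - μ) / μ + r₂ ^ 2 / (r₂ - lam * L) := by
    have : r₂ ≤ r₂ ^ 2 / (r₂ - lam * L) := by
      rw [le_div_iff₀ hr2K]
      nlinarith
    have e : r₂ * (1 - μ) / μ = r₂ / μ - r₂ := by field_simp
    linarith
  have a2 : 2 / (r₁ - L) * ((r₂ / τ) ^ ρ * w ^ ρ)
      ≤ omega0 L lam r₁ r₂ μ τ θ * (μ * w) ^ ρ := by
    have e : 2 / (r₁ - L) * ((r₂ / τ) ^ ρ * w ^ ρ)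
        = 2 / ((r₁ - L) * τ ^ ρ) * (r₂ / μ) ^ ρ * (μ * w) ^ ρ := by
      rw [Real.div_rpow hr2p.le hτ.le, Real.div_rpow hr2p.le hμ.le, Real.mul_rpow hμ.le hw]
      have := (Real.rpow_pos_of_pos hμ ρ).ne'
      have := (Real.rpow_pos_of_pos hτ ρ).ne'
      field_simp
    rw [e]
    unfold omega0
    refine mul_le_mul_of_nonneg_right (mul_le_mul_of_nonneg_left ?_ (by positivity))
      (by positivity)
    exact Real.rpow_le_rpow (by positivity) a1 (by positivity)
  have hω : 0 ≤ omega0 L lam r₁ r₂ μ τ θ := by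
    have : 0 ≤ r₂ * (1 - μ) / μ + r₂ ^ 2 / (r₂ - lam * L) := le_trans (by positivity) a1
    unfold omega0
    positivity
  have a3 := rpow_le_mul_sq hρ (mul_nonneg hμ.le hw) hδ
  calc 4 * r₁ / (r₁ - L) * β * g
      ≤ 4 * r₁ / (r₁ - L) * β * ((r₂ / τ) ^ ρ * w ^ ρ) :=
        mul_le_mul_of_nonneg_left hg (by positivity)
    _ = 2 * r₁ * β * (2 / (r₁ - L) * ((r₂ / τ) ^ ρ * w ^ ρ)) := by ring
    _ ≤ 2 * r₁ * β * (omega0 L lam r₁ r₂ μ τ θ * ((2 * δ) ^ (ρ - 2) * (μ * w) ^ 2)) :=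
        mul_le_mul_of_nonneg_left (a2.trans (mul_le_mul_of_nonneg_left a3 hω)) (by positivity)
    _ = μ / 16 * w ^ 2 * (β * (32 * r₁ * μ * omega0 L lam r₁ r₂ μ τ θ
          * (2 * δ) ^ (ρ - 2))) := by ring
    _ ≤ μ / 16 * w ^ 2 * r₂ := mul_le_mul_of_nonneg_left hcond (by positivity)
    _ = _ := by ring

/-- Rate under the KŁ property with exponent at most `1 / 2`. -/
theorem findsStationary_of_dualKL_le_half (hXne : X.Nonempty) (hXc : IsCompact X)
    (hX : Convex ℝ X) (hYne : Y.Nonempty) (hYc : IsCompact Y) (hY : Convex ℝ Y) {lam : ℝ}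
    (hf : LipschitzGrad f X Y L (lam * L)) (h : StepBounds L (lam * L) r₁ r₂ c α μ σ D)
    (z₀ : E n) (v₀ : E d) {τ θ : ℝ} (hτ : 0 < τ) (hθ0 : 0 < θ) (hθ : θ ≤ 1 / 2)
    (hKL : DualKL f X Y τ θ) :
    ∃ C : ℝ, 0 < C ∧ ∀ (β : ℝ) (T : ℕ), 1 ≤ T → 0 < β → β ≤ 1 / 15 →
      r₁ * β ≤ α * (lam * L) ^ 2 / 1920 →
      β * (32 * r₁ * μ * omega0 L lam r₁ r₂ μ τ θ * (2 * Metric.diam Y) ^ (1 / θ - 2)) ≤ r₂ →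
      ∀ (x : ℕ → E n) (y : ℕ → E d) (z : ℕ → E n) (v : ℕ → E d), z 0 = z₀ → v 0 = v₀ →
      IsRun f X Y r₁ r₂ c α β μ T x y z v →
      FindsStationary f X Y r₁ T x y z
        (C * β ^ (-(1 / 2) : ℝ) * (T : ℝ) ^ (-(1 / 2) : ℝ)) := by
  have hL := h.L_pos
  have hr1 := h.r₁_ge
  have hr2 := h.r₂_ge
  have hK := h.K_pos
  have hμ := h.μ_pos
  have hm : 0 < r₁ - L := by linarith
  have hr1p : 0 < r₁ := by linarith
  have hr2p : 0 < r₂ := by linarith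
  have hρ : 2 ≤ 1 / θ := by
    rw [le_div_iff₀ hθ0]
    linarith
  have hgap : ∀ z v x y, IsSaddle f X Y r₁ r₂ z v x y →
      maxY f Y x - f x y ≤ (r₂ / τ) ^ (1 / θ) * ‖y - v‖ ^ (1 / θ) :=
    fun z v x y hs => hs.gap_le_of_dualKL hf hYc hr2p.le hτ hθ0 hKL
  set Ω := (r₂ / τ) ^ (1 / θ) with hΩd
  have hΩ : 0 ≤ Ω := by positivity
  obtain ⟨ρ₂, hρ₂⟩ := hYc.exists_bound_of_continuousOn (f := fun y => y) continuousOn_id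
  set R := max ρ₂ ‖v₀‖ with hR
  have hR0 : 0 ≤ R := (norm_nonneg _).trans (le_max_right _ _)
  obtain ⟨N, hN⟩ : ∃ N : ℕ, 0 < Metric.diam Y → ∀ (T : ℕ) (y v : ℕ → E d), v 0 = v₀ →
      (∀ t ≤ T, y (t + 1) ∈ Y) → (∀ t ≤ T, v (t + 1) = v t + μ • (y (t + 1) - v t)) →
      ∀ t, N ≤ t → t ≤ T + 1 → ∀ yb ∈ Y, μ * ‖yb - v t‖ ≤ 2 * Metric.diam Y := by
    by_cases hd : 0 < Metric.diam Y
    · obtain ⟨N, hN⟩ := exists_forall_mul_norm_le hYc hμ h.μ_lt_one v₀ hd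
      exact ⟨N, fun _ => hN⟩
    · exact ⟨0, fun hd' => absurd hd' hd⟩
  set e₀ := 4 * r₁ / (r₁ - L) * (Ω * (2 * R) ^ (1 / θ)) with he₀
  have he₀0 : 0 ≤ e₀ := by positivity
  obtain ⟨C, hC, hmain⟩ := exists_good_step hXne hXc hX hYne hYc hY hf h z₀ v₀
    (by positivity : 0 ≤ N * e₀)
  refine ⟨C * (1 + √(Ω * (2 * R) ^ (1 / θ - 2)) * C), by positivity, ?_⟩
  intro β T hT hβ hβ15 hβr hcond x y z v hz0 hv0 hrun
  have hTp : (0 : ℝ) < T := by exact_mod_cast hT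
  have hym : ∀ t ≤ T, y (t + 1) ∈ Y := fun t ht => (hrun.stepY t ht).1
  have hvR := norm_extrapolation_iterate_le hμ.le h.μ_lt_one.le
    (fun t ht => (hρ₂ _ (hym t ht)).trans (le_max_left _ _))
    (by rw [hv0]; exact le_max_right _ _) hrun.stepV
  have hwR : ∀ t ≤ T, ∀ yb ∈ Y, ‖yb - v t‖ ≤ 2 * R := fun t ht yb hyb => by
    have a1 := norm_sub_le yb (v t)
    have a2 := (hρ₂ _ hyb).trans (le_max_left _ ‖v₀‖)
    have a3 := hvR t (by omega)
    linarith
  obtain ⟨t, ht1, htT, xb, yb, hs, hw, hGS, hOS⟩ := hmain β T hT hβ hβ15 hβr x y z v hz0 hv0 hrun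
    (fun t => if t ≤ N then e₀ else 0) (by
      rw [← Finset.sum_filter, Finset.sum_const, nsmul_eq_mul]
      refine mul_le_mul_of_nonneg_right ?_ he₀0
      have : (Finset.range T).filter (fun i => i + 1 ≤ N) ⊆ Finset.range N := by
        intro i hi
        rw [Finset.mem_filter] at hi
        exact Finset.mem_range.2 hi.2
      exact_mod_cast (Finset.card_le_card this).trans (Finset.card_range N).le)
    (by
      intro t _ htT xb yb hs
      have w0 : 0 ≤ r₂ * μ / 16 * ‖yb - v t‖ ^ 2 := by positivity
      have g1 := hgap _ _ _ _ hs
      split_ifs with htN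
      · have a1 : ‖yb - v t‖ ^ (1 / θ) ≤ (2 * R) ^ (1 / θ) :=
          Real.rpow_le_rpow (norm_nonneg _) (hwR t htT yb hs.mem) (by positivity)
        have a2 := g1.trans (mul_le_mul_of_nonneg_left a1 hΩ)
        have a3 : 4 * r₁ / (r₁ - L) * β * (maxY f Y xb - f xb yb) ≤ e₀ := by
          have h1 := hs.gap_nonneg hf hYc
          calc 4 * r₁ / (r₁ - L) * β * (maxY f Y xb - f xb yb)
              = 4 * r₁ / (r₁ - L) * (β * (maxY f Y xb - f xb yb)) := by ring
            _ ≤ e₀ := by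
              refine mul_le_mul_of_nonneg_left ?_ (by positivity)
              linarith [mul_le_mul_of_nonneg_right hβ15 h1]
        linarith
      · rw [sub_nonpos]
        rcases (Metric.diam_nonneg (s := Y)).eq_or_lt with hd | hd
        · rw [hs.gap_eq_zero_of_diam hf hYc hd.symm, mul_zero]
          exact w0
        · exact gap_absorbed h hβ hτ hθ0 hθ (norm_nonneg _) g1
            (hN hd T y v hv0 hym hrun.stepV t (by omega) (by omega) yb hs.mem) hcond)
  have b1 : √(maxY f Y xb - f xb yb) ≤ √(Ω * (2 * R) ^ (1 / θ - 2)) * (C * (√T)⁻¹) := by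
    have a1 := rpow_le_mul_sq hρ (norm_nonneg _) (hwR t htT yb hs.mem)
    have a2 : maxY f Y xb - f xb yb ≤ Ω * (2 * R) ^ (1 / θ - 2) * ‖yb - v t‖ ^ 2 := by
      refine (hgap _ _ _ _ hs).trans ?_
      rw [mul_assoc]
      exact mul_le_mul_of_nonneg_left a1 hΩ
    refine (Real.sqrt_le_sqrt a2).trans ?_
    rw [Real.sqrt_mul (by positivity), Real.sqrt_sq (norm_nonneg _)]
    exact mul_le_mul_of_nonneg_left hw (Real.sqrt_nonneg _)
  have b2 : (√T)⁻¹ ≤ (√(β * T))⁻¹ :=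
    inv_anti₀ (Real.sqrt_pos.2 (mul_pos hβ hTp)) (Real.sqrt_le_sqrt (by
      linarith [mul_le_mul_of_nonneg_right hβ15 hTp.le]))
  have b3 : (√(β * T))⁻¹ = β ^ (-(1 / 2) : ℝ) * (T : ℝ) ^ (-(1 / 2) : ℝ) := by
    rw [inv_sqrt_eq_rpow (by positivity), Real.mul_rpow hβ.le hTp.le]
  rw [b3] at hGS hOS b2
  set ε₀ := β ^ (-(1 / 2) : ℝ) * (T : ℝ) ^ (-(1 / 2) : ℝ) with hε₀
  have hε₀0 : 0 ≤ ε₀ := by positivity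
  have b4 := mul_le_mul_of_nonneg_left b2
    (by positivity : 0 ≤ √(Ω * (2 * R) ^ (1 / θ - 2)) * C)
  have b5 : 0 ≤ √(Ω * (2 * R) ^ (1 / θ - 2)) * C := by positivity
  refine ⟨t, ht1, htT, hGS.mono ?_, hOS.mono ?_⟩
  · rw [mul_assoc _ (β ^ (-(1 / 2) : ℝ)), ← hε₀, mul_assoc]
    refine mul_le_mul_of_nonneg_left ?_ hC.le
    linarith [mul_nonneg b5 hε₀0]
  · rw [mul_assoc _ (β ^ (-(1 / 2) : ℝ)), ← hε₀, mul_assoc C]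
    refine mul_le_mul_of_nonneg_left ?_ hC.le
    linarith

end DSGDA

theorem theorem3 {n d : ℕ}
    (f : DSGDA.E n → DSGDA.E d → ℝ) (X : Set (DSGDA.E n)) (Y : Set (DSGDA.E d))
    (hXne : X.Nonempty) (hXcpt : IsCompact X) (hXcvx : Convex ℝ X)
    (hYne : Y.Nonempty) (hYcpt : IsCompact Y) (hYcvx : Convex ℝ Y)
    (L lam : ℝ) (hL : 0 < L) (hlam : 0 < lam)
    (hf : DSGDA.LipschitzGrad f X Y L (lam * L))
    (r₁ r₂ c α μ : ℝ) (hpar : DSGDA.ParamBounds L lam r₁ r₂ c α μ)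
    (x₀ : DSGDA.E n) (y₀ : DSGDA.E d) (z₀ : DSGDA.E n) (v₀ : DSGDA.E d) :
    -- KL exponent in (1/2, 1)
    (∀ τ θ : ℝ, 0 < τ → 1 / 2 < θ → θ < 1 → DSGDA.DualKL f X Y τ θ →
      ∀ κ₂ : ℝ, 0 < κ₂ → ∃ C : ℝ, 0 < C ∧
        ∀ (κ₁ β : ℝ) (T : ℕ), 0 < κ₁ → 1 ≤ T → DSGDA.BetaBounds L lam r₁ α β →
          κ₁ * (T : ℝ) ^ (-((2 * θ - 1) / (2 * θ))) ≤ β →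
          β ≤ κ₂ * (T : ℝ) ^ (-((2 * θ - 1) / (2 * θ))) →
          ∀ (x : ℕ → DSGDA.E n) (y : ℕ → DSGDA.E d) (z : ℕ → DSGDA.E n) (v : ℕ → DSGDA.E d),
            x 0 = x₀ → y 0 = y₀ → z 0 = z₀ → v 0 = v₀ →
            DSGDA.IsRun f X Y r₁ r₂ c α β μ T x y z v →
            DSGDA.FindsStationary f X Y r₁ T x y z
              (C * κ₁ ^ (-(1 / 2) : ℝ) * (T : ℝ) ^ (-(1 / (4 * θ))))) ∧
    -- KL exponent in (0, 1/2]
    (∀ τ θ : ℝ, 0 < τ → 0 < θ → θ ≤ 1 / 2 → DSGDA.DualKL f X Y τ θ →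
      ∃ C : ℝ, 0 < C ∧
        ∀ (β : ℝ) (T : ℕ), 1 ≤ T → DSGDA.BetaBounds L lam r₁ α β →
          β * (32 * r₁ * μ * DSGDA.omega0 L lam r₁ r₂ μ τ θ *
            (2 * Metric.diam Y) ^ (1 / θ - 2)) ≤ r₂ →
          ∀ (x : ℕ → DSGDA.E n) (y : ℕ → DSGDA.E d) (z : ℕ → DSGDA.E n) (v : ℕ → DSGDA.E d),
            x 0 = x₀ → y 0 = y₀ → z 0 = z₀ → v 0 = v₀ →
            DSGDA.IsRun f X Y r₁ r₂ c α β μ T x y z v →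
            DSGDA.FindsStationary f X Y r₁ T x y z
              (C * β ^ (-(1 / 2) : ℝ) * (T : ℝ) ^ (-(1 / 2) : ℝ))) ∧
    -- concave dual function
    (DSGDA.DualConcave f X Y →
      ∀ κ₂ : ℝ, 0 < κ₂ → ∃ C : ℝ, 0 < C ∧
        ∀ (κ₁ β : ℝ) (T : ℕ), 0 < κ₁ → 1 ≤ T → DSGDA.BetaBounds L lam r₁ α β →
          κ₁ * (T : ℝ) ^ (-(1 / 2) : ℝ) ≤ β →
          β ≤ κ₂ * (T : ℝ) ^ (-(1 / 2) : ℝ) →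
          ∀ (x : ℕ → DSGDA.E n) (y : ℕ → DSGDA.E d) (z : ℕ → DSGDA.E n) (v : ℕ → DSGDA.E d),
            x 0 = x₀ → y 0 = y₀ → z 0 = z₀ → v 0 = v₀ →
            DSGDA.IsRun f X Y r₁ r₂ c α β μ T x y z v →
            DSGDA.FindsStationary f X Y r₁ T x y z
              (C * κ₁ ^ (-(1 / 2) : ℝ) * (T : ℝ) ^ (-(1 / 4) : ℝ))) := by
  have h := hpar.stepBounds hL hlam
  have hr1p : 0 < r₁ := by linarith [hpar.r₁_ge]
  refine ⟨fun τ θ hτ hθ _ hKL κ₂ hκ₂ => ?_, fun τ θ hτ hθ0 hθ hKL => ?_, fun hcc κ₂ hκ₂ => ?_⟩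
  · obtain ⟨C, hC, H⟩ := DSGDA.findsStationary_of_gap_le_rpow hXne hXcpt hXcvx hYne hYcpt hYcvx hf h
      z₀ v₀ hθ (Real.rpow_nonneg (div_nonneg (by linarith [h.r₂_ge, h.K_pos]) hτ.le) _)
      (fun z v x y hs => hs.gap_le_of_dualKL hf hYcpt (by linarith [h.r₂_ge, h.K_pos]) hτ
        (by linarith) hKL) hκ₂
    exact ⟨C, hC, fun κ₁ β T hκ₁ hT hβ h1 h2 x y z v _ _ hz hv hrun =>
      H κ₁ β T hκ₁ hT hβ.β_pos (hβ.le_fifteenth hlam hr1p) (hβ.mul_le hlam hr1p) h1 h2 x y z v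
        hz hv hrun⟩
  · obtain ⟨C, hC, H⟩ := DSGDA.findsStationary_of_dualKL_le_half hXne hXcpt hXcvx hYne hYcpt hYcvx
      hf h z₀ v₀ hτ hθ0 hθ hKL
    exact ⟨C, hC, fun β T hT hβ h1 x y z v _ _ hz hv hrun =>
      H β T hT hβ.β_pos (hβ.le_fifteenth hlam hr1p) (hβ.mul_le hlam hr1p) h1 x y z v hz hv hrun⟩
  · obtain ⟨C, hC, H⟩ := DSGDA.findsStationary_of_gap_le_rpow (θ := 1)
      (Ω := r₂ * Metric.diam Y) hXne hXcpt hXcvx hYne hYcpt hYcvx hf h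
      z₀ v₀ (by norm_num)
      (mul_nonneg (by linarith [h.r₂_ge, h.K_pos]) Metric.diam_nonneg)
      (fun z v x y hs => by
        rw [div_one, Real.rpow_one]
        exact hs.gap_le_of_concave hf hYcpt (by linarith [h.r₂_ge, h.K_pos]) hcc) hκ₂
    have e1 : (-((2 * 1 - 1) / (2 * 1)) : ℝ) = -(1 / 2) := by norm_num
    have e2 : (-(1 / (4 * 1)) : ℝ) = -(1 / 4) := by norm_num
    rw [e1, e2] at H
    exact ⟨C, hC, fun κ₁ β T hκ₁ hT hβ h1 h2 x y z v _ _ hz hv hrun =>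
      H κ₁ β T hκ₁ hT hβ.β_pos (hβ.le_fifteenth hlam hr1p) (hβ.mul_le hlam hr1p) h1 h2 x y z v
        hz hv hrun⟩
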